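/- **Setting.** For a probability measure $\mu$ on $\mathbf R$ let $\widehat\mu(\xi)=\int e^{-2\pi i\xi x}\,d\mu(x)$ and let $\dim_{\mathrm F}\mu$ be the supremum of the $s\in[0,1]$ for which there is a constant $K$ with $|\widehat\mu(\xi)|\le K|\xi|^{-s/2}$ for all $\xi\ne 0$. For a Borel set $F\subset\mathbf R$ let $\dim_{\mathrm F}F$ be the supremum of $\dim_{\mathrm F}\mu$ over the probability measures $\mu$ on $\mathbf R$ with $\mu(F)=1$ (and $\dim_{\mathrm F}\emptyset=0$). Let $(c_k)_{k\ge1}$ be a (weakly) increasing sequence in $(0,1/2)$ that converges to $1/2$ and satisfies $\prod_{k=1}^\infty 2c_k>0$ and $\lim_{k\to\infty}\frac{\log(1-2c_k)}{k}=0$. Let $C_0=[0,1]$ and, for $k\ge1$, let $C_k$ be obtained from $C_{k-1}$ by removing from every connected component $I$ of $C_{k-1}$ the open interval that is concentric with $I$ and has length $(1-2c_k)|I|$. Let $C=\bigcap_{k\ge0}C_k$. Let $m$ be a positive integer and $\alpha\in[0,1]$. For $t>0$ put $\delta(t)=1/\max(-\log t,\log 2)$ if $\alpha=0$ and $\delta(t)=t^\alpha$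 if $\alpha\in(0,1]$. Let $D$ be the set of bounded connected components of $\mathbf R\setminus C$ and let $\delta_U=|U|^m\delta(|U|)$ for $U\in D$, where $|U|$ is the length of $U$. Let $\nu$ be a probability measure on $[0,1]$ such that $\widehat\nu(\xi)\to0$ as $|\xi|\to\infty$. Let $\Omega=\prod_{U\in D}[0,\delta_U]$ carry the product probability measure $P$ whose marginal on the coordinate $U$ is the image of $\nu$ under $x\mapsto\delta_U x$. Let $\varphi:\mathbf R\to\mathbf R$ be a (weakly) increasing $C^\infty$ function with $\varphi=0$ on $(-\infty,0]$ and $\varphi=1$ on $[1,\infty)$, and for $\omega\in\Omega$ let $$f_\omega(x)=x+\sum_{U\in D}\omega_U\,\varphi\!\left(\frac{x-\inf U}{|U|}\right),\qquad x\in\mathbf R.$$ **Theorem.** Let $s\ge0$ and let $F\subset\mathbf R$ be a Borel set whose $s$-dimensional Hausdorff measure satisfies $\mathcal H^s(F)>0$. Then there is some $t\in\mathbf R$ such that for $P$-almost every $\omega\in\Omega$ $$\dim_{\mathrm F} f_\omega\bigl(C\cap(F+t)\bigr)\ge\frac{s}{m+\alpha}.$$ -/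

import Mathlib

open MeasureTheory Filter Topology Set

noncomputable section

namespace RandomDiffeo

/-! ### Fourier dimension -/

/-- The Fourier transform `ξ ↦ ∫ e(-ξ x) dμ(x)` of a measure on the line, where
`e(y) = exp(2πiy)` (this is `Real.fourierChar`). -/
def fourierTransform (μ : Measure ℝ) (ξ : ℝ) : ℂ :=
  ∫ x, (Real.fourierChar (-(ξ * x)) : ℂ) ∂μ

/-- The Fourier dimension of a probability measure: the supremum of the `s ∈ [0, 1]` such that
the Fourier transform is `O(|ξ|^(-s/2))` (at `ξ = 0` the right side is infinite or `1`, so there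
is no condition there). -/
def dimFMeasure (μ : Measure ℝ) : ℝ :=
  sSup {s : ℝ | s ∈ Icc (0 : ℝ) 1 ∧
    ∃ K : ℝ, ∀ ξ : ℝ, ξ ≠ 0 → ‖fourierTransform μ ξ‖ ≤ K * |ξ| ^ (-s / 2)}

/-- The Fourier dimension of a Borel set: the supremum of the Fourier dimensions of the
probability measures that give the set full measure (and `0` for the empty set). -/
def dimFSet (F : Set ℝ) : ℝ :=
  sSup {d : ℝ | ∃ μ : Measure ℝ, IsProbabilityMeasure μ ∧ μ F = 1 ∧ d = dimFMeasure μ}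

/-! ### The random map -/

/-- The bounded connected components of the complement of `E`. -/
def holes (E : Set ℝ) : Set (Set ℝ) :=
  {U | (∃ x ∈ Eᶜ, U = connectedComponentIn Eᶜ x) ∧ Bornology.IsBounded U}

/-- The function `δ`; it equals `1 / max (-log t, log 2)` if `α = 0`, and `t ^ α` otherwise. -/
def deltaFun (α t : ℝ) : ℝ :=
  if α = 0 then 1 / max (-Real.log t) (Real.log 2) else t ^ α

/-- The number `δ_U = |U| ^ m * δ(|U|)`, where `|U|` is the length of the interval `U`. -/
def holeDelta (m : ℕ) (α : ℝ) (U : Set ℝ) : ℝ :=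
  Metric.diam U ^ m * deltaFun α (Metric.diam U)

theorem holeDelta_nonneg (m : ℕ) (α : ℝ) (U : Set ℝ) : 0 ≤ holeDelta m α U := by
  unfold holeDelta deltaFun
  have h : 0 ≤ Metric.diam U := Metric.diam_nonneg
  have h2 : 0 ≤ max (-Real.log (Metric.diam U)) (Real.log 2) :=
    le_max_of_le_right (Real.log_nonneg (by norm_num))
  split_ifs <;> positivity

/-- The product space `Ω` of the intervals `[0, δ_U]` over the holes `U` of `E`. -/
abbrev Omega (E : Set ℝ) (m : ℕ) (α : ℝ) : Type :=
  (U : holes E) → Icc (0 : ℝ) (holeDelta m α U)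

/-- The map `x ↦ δ_U x` from `[0, 1]` to `[0, δ_U]`. -/
def scale (m : ℕ) (α : ℝ) (U : Set ℝ) (x : Icc (0 : ℝ) 1) : Icc (0 : ℝ) (holeDelta m α U) :=
  ⟨holeDelta m α U * x, mul_nonneg (holeDelta_nonneg m α U) x.2.1,
    mul_le_of_le_one_right (holeDelta_nonneg m α U) x.2.2⟩

/-- The product measure on `Ω` whose marginal at `U` is the image of `ν` under `x ↦ δ_U x`. -/
def productMeasure (E : Set ℝ) (m : ℕ) (α : ℝ) (ν : Measure (Icc (0 : ℝ) 1)) :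
    Measure (Omega E m α) :=
  Measure.infinitePi fun U : holes E => ν.map (scale m α U)

theorem measurable_scale (m : ℕ) (α : ℝ) (U : Set ℝ) : Measurable (scale m α U) :=
  (measurable_subtype_coe.const_mul (holeDelta m α U)).subtype_mk

instance isProbabilityMeasure_productMeasure (E : Set ℝ) (m : ℕ) (α : ℝ)
    (ν : Measure (Icc (0 : ℝ) 1)) [IsProbabilityMeasure ν] :
    IsProbabilityMeasure (productMeasure E m α ν) := by
  have h : ∀ U : holes E, IsProbabilityMeasure (ν.map (scale m α U)) := fun U =>
    Measure.isProbabilityMeasure_map (measurable_scale m α U).aemeasurable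
  unfold productMeasure
  infer_instance

/-- The function `f_ω` on the line, `f_ω(x) = x + ∑_U ω_U φ((x - inf U) / |U|)`. -/
def randomMap (φ : ℝ → ℝ) {E : Set ℝ} {m : ℕ} {α : ℝ} (ω : Omega E m α) (x : ℝ) : ℝ :=
  x + ∑' U : holes E, (ω U : ℝ) * φ ((x - sInf (U : Set ℝ)) / Metric.diam (U : Set ℝ))

/-! ### The Cantor set

In a sequence `c : ℕ → ℝ` the term `c k` is the ratio used in step `k + 1` of the construction. -/

/-- The pairs `(a, b)` such that `[a, b]` is one of the intervals of the `k`-th stage. Removing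
from `[a, b]` the concentric open interval of length `(1 - 2c)(b - a)` leaves the intervals
`[a, a + c(b - a)]` and `[b - c(b - a), b]`. -/
def cantorIntervals (c : ℕ → ℝ) : ℕ → Set (ℝ × ℝ)
  | 0 => {(0, 1)}
  | k + 1 => ⋃ I ∈ cantorIntervals c k,
      {(I.1, I.1 + c k * (I.2 - I.1)), (I.2 - c k * (I.2 - I.1), I.2)}

/-- The `k`-th stage of the construction. -/
def cantorStage (c : ℕ → ℝ) (k : ℕ) : Set ℝ :=
  ⋃ I ∈ cantorIntervals c k, Icc I.1 I.2

/-- The Cantor set, the intersection of all the stages. -/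
def cantorSet (c : ℕ → ℝ) : Set ℝ :=
  ⋂ k, cantorStage c k

end RandomDiffeo

end

open RandomDiffeo

/-!
# Images of Borel sets under a random diffeomorphism have large Fourier dimension

Write `C` for the Cantor set, and suppose that `0 < s ≤ 1` (for `s = 0` there is nothing to prove,
and `s > 1` is impossible on the line).

**A measure.** Frostman's lemma (`exists_frostman_measure`) gives a finite nonzero measure on `F`
whose mass on every interval of length `2 ^ (-n)` is `O(2 ^ (-s n))`. The content used for this is
the dyadic one: it is strongly subadditive, hence continuous from below along all increasing
sequences of sets (`dyadicContent_iUnion_le`), so Choquet's argument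
(`exists_isCompact_le_of_isOpen`) finds a compact subset of `F` of positive content `Φ`. On a
compact set `K ⊆ ℝ` the Stieltjes measure of `x ↦ Φ (K ∩ (-∞, x))` does the job. Since `C` has
positive length, Tonelli's theorem provides a translate of that measure which charges `C`
(`exists_translate_measure`). Let `μ` be its normalized restriction to `C`.

**Moments.** On `C` the random map is `x ↦ x + ∑ ω_U`, summed over the holes `U` to the left of `x`.
The moment of order `2 q` of the Fourier transform of the image of `μ` at `ξ` is the integral over
`2 q` points of `C`, distributed according to `μ`, of the expectation of a random phase, and by
independence this expectation is at most the product over the holes `U` of the numbers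
`|ν̂ (ξ k_U δ_U)|`, where `k_U` is a signed count of the points to the right of `U`
(`norm_integral_phase_randomMap_le`). If `ξ` is about `2 ^ (K β)` with `β` slightly larger than
`m + α`, then the holes between the intervals of stage `K` of the construction are so long that
each of these factors with `k_U ≠ 0` is at most `1 / 2`
(`exists_le_holeDelta_cantorHole`). Sort the points and pair the odd ones with their
successors: between the members of a pair, `k_U` is odd. So either some pair is more than `q K`
intervals of stage `K` apart, and the product is at most `2 ^ (-q K)`; or all `q` pairs are close,
which has probability `O((K 2 ^ (-s K)) ^ q)` (`integral_norm_fourierTransform_pow_le`). Hence the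
moment is `O(|ξ| ^ (-q γ))` for every `γ < s / (m + α)`
(`exists_integral_norm_fourierTransform_pow_le`).

**Almost sure decay.** As `q` is arbitrary, a Borel-Cantelli argument (`ae_exists_le_of_moments`)
gives decay of order `|ξ| ^ (-γ / 2)` along the square roots of the integers, and the Lipschitz
continuity of the Fourier transform extends it to all `ξ` (`le_dimFMeasure_of_sqrt`).
-/

namespace RandomDiffeo

open scoped ENNReal

/-! ### Dyadic content -/

/-- The half-open dyadic interval `[k / 2 ^ n, (k + 1) / 2 ^ n)` with index `(n, k)`, described
through the floor function. -/
def dyadicCell (d : ℕ × ℤ) : Set ℝ := {x | ⌊x * 2 ^ d.1⌋ = d.2}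

theorem dyadicCell_subset {d e : ℕ × ℤ} {x : ℝ} (hd : x ∈ dyadicCell d) (he : x ∈ dyadicCell e)
    (h : d.1 ≤ e.1) : dyadicCell e ⊆ dyadicCell d := by
  intro y hy
  have key : ∀ z : ℝ, ⌊z * 2 ^ d.1⌋ = ⌊z * 2 ^ e.1⌋ / ((2 ^ (e.1 - d.1) : ℕ) : ℤ) := by
    intro z
    rw [← Int.floor_div_natCast]
    congr 1
    have : (2 : ℝ) ^ e.1 = 2 ^ d.1 * 2 ^ (e.1 - d.1) := by rw [← pow_add]; congr 1; omega
    push_cast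
    rw [this]; field_simp
  simp only [dyadicCell, mem_ofPred_eq] at *
  rw [key, hy, ← he, ← key, hd]

theorem dyadicCell_eq_of_level_eq {d e : ℕ × ℤ} {x : ℝ} (hd : x ∈ dyadicCell d)
    (he : x ∈ dyadicCell e) (h : d.1 = e.1) : d = e := by
  simp only [dyadicCell, mem_ofPred_eq] at *
  exact Prod.ext h (by rw [← hd, ← he, h])

theorem dyadicCell_subset_Ico (d : ℕ × ℤ) :
    dyadicCell d ⊆ Ico (d.2 * (1 / 2 : ℝ) ^ d.1) ((d.2 + 1) * (1 / 2 : ℝ) ^ d.1) := by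
  intro x hx
  have h := Int.floor_eq_iff.1 hx
  have hp : (0 : ℝ) < 2 ^ d.1 := by positivity
  rw [one_div, inv_pow, ← div_eq_mul_inv, ← div_eq_mul_inv]
  exact ⟨(div_le_iff₀ hp).2 h.1, (lt_div_iff₀ hp).2 h.2⟩

/-- The weight `2 ^ (-s n)`, the `s`-th power of the length of a dyadic interval of level `n`. -/
noncomputable def levelWeight (s : ℝ) (n : ℕ) : ℝ≥0∞ := ENNReal.ofReal ((2 : ℝ) ^ (-(s * n)))

/-- The measure on the set of indices of dyadic intervals for which a family of intervals has the
sum of the `s`-th powers of its lengths as its mass. -/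
noncomputable def familyWeight (s : ℝ) : Measure (ℕ × ℤ) :=
  (Measure.count : Measure (ℕ × ℤ)).withDensity fun d => levelWeight s d.1

/-- The `s`-dimensional dyadic content of a set: the infimum of `∑ |I| ^ s` over the coverings by
dyadic intervals `I` of length at most `1`. -/
noncomputable def dyadicContent (s : ℝ) (E : Set ℝ) : ℝ≥0∞ :=
  ⨅ (A : Set (ℕ × ℤ)) (_ : E ⊆ ⋃ d ∈ A, dyadicCell d), familyWeight s A

theorem familyWeight_singleton (s : ℝ) (d : ℕ × ℤ) :
    familyWeight s {d} = levelWeight s d.1 := by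
  rw [familyWeight, withDensity_apply _ (measurableSet_singleton d)]
  simp

theorem familyWeight_eq_tsum (s : ℝ) (A : Set (ℕ × ℤ)) :
    familyWeight s A = ∑' d : A, levelWeight s (d : ℕ × ℤ).1 := by
  rw [← Measure.tsum_indicator_apply_singleton _ A (MeasurableSet.of_discrete),
    tsum_subtype A (fun d => levelWeight s d.1)]
  congr 1
  ext d
  simp only [indicator, familyWeight_singleton]

theorem dyadicContent_le {s : ℝ} {E : Set ℝ} {A : Set (ℕ × ℤ)}
    (h : E ⊆ ⋃ d ∈ A, dyadicCell d) : dyadicContent s E ≤ familyWeight s A :=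
  iInf₂_le A h

theorem dyadicContent_mono (s : ℝ) {E E' : Set ℝ} (h : E ⊆ E') :
    dyadicContent s E ≤ dyadicContent s E' :=
  le_iInf₂ fun _ hA => dyadicContent_le (h.trans hA)

theorem exists_family_lt {s : ℝ} {E : Set ℝ} {c : ℝ≥0∞} (h : dyadicContent s E < c) :
    ∃ A : Set (ℕ × ℤ), E ⊆ ⋃ d ∈ A, dyadicCell d ∧ familyWeight s A < c := by
  simpa [dyadicContent, iInf_lt_iff] using h

theorem dyadicContent_empty (s : ℝ) : dyadicContent s ∅ = 0 :=
  le_antisymm ((dyadicContent_le (A := ∅) (by simp)).trans (by simp)) bot_le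

theorem dyadicContent_union_le (s : ℝ) (E E' : Set ℝ) :
    dyadicContent s (E ∪ E') ≤ dyadicContent s E + dyadicContent s E' := by
  refine ENNReal.le_of_forall_pos_le_add fun ε hε hfin => ?_
  have hε' : (ε / 2 : ℝ≥0∞) ≠ 0 := by simpa using hε.ne'
  have h1 := ne_top_of_lt (lt_of_le_of_lt le_self_add hfin)
  have h2 := ne_top_of_lt (lt_of_le_of_lt le_add_self hfin)
  obtain ⟨A, hA, hA'⟩ := exists_family_lt (ENNReal.lt_add_right h1 hε')
  obtain ⟨B, hB, hB'⟩ := exists_family_lt (ENNReal.lt_add_right h2 hε')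
  calc dyadicContent s (E ∪ E') ≤ familyWeight s (A ∪ B) := by
        refine dyadicContent_le (union_subset ?_ ?_)
        · exact hA.trans (biUnion_subset_biUnion_left subset_union_left)
        · exact hB.trans (biUnion_subset_biUnion_left subset_union_right)
    _ ≤ familyWeight s A + familyWeight s B := measure_union_le _ _
    _ ≤ (dyadicContent s E + ε / 2) + (dyadicContent s E' + ε / 2) := add_le_add hA'.le hB'.le
    _ = _ := by rw [add_add_add_comm, ENNReal.add_halves]

/-- The members of a family of dyadic intervals that are not strictly contained in another
member. -/
def maximalCells (A : Set (ℕ × ℤ)) : Set (ℕ × ℤ) :=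
  {d ∈ A | ∀ e ∈ A, dyadicCell d ⊆ dyadicCell e → d.1 ≤ e.1}

theorem maximalCells_subset (A : Set (ℕ × ℤ)) : maximalCells A ⊆ A := fun _ h => h.1

theorem exists_maximalCell {A : Set (ℕ × ℤ)} {d : ℕ × ℤ} {x : ℝ} (hd : d ∈ A)
    (hx : x ∈ dyadicCell d) :
    ∃ e ∈ maximalCells A, x ∈ dyadicCell e ∧ e.1 ≤ d.1 := by
  classical
  have hex : ∃ n, ∃ e ∈ A, x ∈ dyadicCell e ∧ e.1 = n := ⟨d.1, d, hd, hx, rfl⟩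
  obtain ⟨e, he, hxe, hen⟩ := Nat.find_spec hex
  refine ⟨e, ⟨he, fun e' he' hsub => ?_⟩, hxe, ?_⟩
  · rw [hen]; exact Nat.find_min' hex ⟨e', he', hsub hxe, rfl⟩
  · rw [hen]; exact Nat.find_min' hex ⟨d, hd, hx, rfl⟩

theorem iUnion_maximalCells (A : Set (ℕ × ℤ)) :
    ⋃ d ∈ maximalCells A, dyadicCell d = ⋃ d ∈ A, dyadicCell d := by
  refine Subset.antisymm (biUnion_subset_biUnion_left (maximalCells_subset A)) fun x hx => ?_
  simp only [mem_iUnion] at hx ⊢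
  obtain ⟨d, hd, hx⟩ := hx
  obtain ⟨e, he, hxe, -⟩ := exists_maximalCell hd hx
  exact ⟨e, he, hxe⟩

/-- Strong subadditivity of the dyadic content: in the union of two families the maximal intervals
cover the union of the two covered sets, and all that is left over (the non-maximal intervals
and the second copies of the common ones) still covers their intersection. -/
theorem familyWeight_maximalCells_add_le (s : ℝ) (A B : Set (ℕ × ℤ)) :
    familyWeight s (maximalCells (A ∪ B)) +
      dyadicContent s ((⋃ d ∈ A, dyadicCell d) ∩ ⋃ d ∈ B, dyadicCell d) ≤
      familyWeight s A + familyWeight s B := by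
  have hcov : (⋃ d ∈ A, dyadicCell d) ∩ (⋃ d ∈ B, dyadicCell d) ⊆
      ⋃ d ∈ ((A ∪ B) \ maximalCells (A ∪ B)) ∪ (A ∩ B), dyadicCell d := by
    rintro x ⟨hxA, hxB⟩
    simp only [mem_iUnion] at hxA hxB ⊢
    obtain ⟨a, ha, hxa⟩ := hxA
    obtain ⟨b, hb, hxb⟩ := hxB
    rcases lt_trichotomy a.1 b.1 with h | h | h
    · exact ⟨b, Or.inl ⟨Or.inr hb, fun hm =>
        absurd (hm.2 a (Or.inl ha) (dyadicCell_subset hxa hxb h.le)) (by omega)⟩, hxb⟩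
    · obtain rfl := dyadicCell_eq_of_level_eq hxa hxb h
      exact ⟨a, Or.inr ⟨ha, hb⟩, hxa⟩
    · exact ⟨a, Or.inl ⟨Or.inl ha, fun hm =>
        absurd (hm.2 b (Or.inr hb) (dyadicCell_subset hxb hxa h.le)) (by omega)⟩, hxa⟩
  calc _ ≤ familyWeight s (maximalCells (A ∪ B)) +
        (familyWeight s ((A ∪ B) \ maximalCells (A ∪ B)) + familyWeight s (A ∩ B)) := by
        gcongr
        exact (dyadicContent_le hcov).trans (measure_union_le _ _)
    _ = familyWeight s (A ∪ B) + familyWeight s (A ∩ B) := by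
        rw [← add_assoc]
        congr 1
        conv_rhs => rw [← measure_inter_add_sdiff (A ∪ B)
          (MeasurableSet.of_discrete (s := maximalCells (A ∪ B))),
          inter_eq_self_of_subset_right (maximalCells_subset _)]
    _ = _ := measure_union_add_inter _ MeasurableSet.of_discrete

/-- The dyadic content is continuous from below along arbitrary increasing sequences of sets.
Near-optimal coverings of the sets are merged one after the other, keeping only maximal intervals;
by strong subadditivity the total weight exceeds the content by no more than the sum of the
errors. -/
theorem dyadicContent_iUnion_le (s : ℝ) {E : ℕ → Set ℝ} (hE : Monotone E) :
    dyadicContent s (⋃ n, E n) ≤ ⨆ n, dyadicContent s (E n) := by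
  refine ENNReal.le_of_forall_pos_le_add fun ε hε hfin => ?_
  have hEfin : ∀ n, dyadicContent s (E n) ≠ ∞ := fun n =>
    ne_top_of_le_ne_top hfin.ne (le_iSup (fun n => dyadicContent s (E n)) n)
  obtain ⟨η, hη, hηsum⟩ := ENNReal.exists_pos_sum_of_countable (ENNReal.coe_pos.2 hε).ne' ℕ
  have hA : ∀ n, ∃ A : Set (ℕ × ℤ), E n ⊆ ⋃ d ∈ A, dyadicCell d ∧
      familyWeight s A < dyadicContent s (E n) + η n := fun n =>
    exists_family_lt (ENNReal.lt_add_right (hEfin n) (ENNReal.coe_pos.2 (hη n)).ne')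
  choose A hcov hlt using hA
  let V : ℕ → Set (ℕ × ℤ) := fun n => Nat.rec (A 0) (fun k W => maximalCells (W ∪ A (k + 1))) n
  have hV : ∀ n, V (n + 1) = maximalCells (V n ∪ A (n + 1)) := fun n => rfl
  have hVcov : ∀ n, E n ⊆ ⋃ d ∈ V n, dyadicCell d := by
    intro n
    cases n with
    | zero => exact hcov 0
    | succ n =>
      rw [hV, iUnion_maximalCells]
      exact (hcov (n + 1)).trans (biUnion_subset_biUnion_left subset_union_right)
  have hVw : ∀ n, familyWeight s (V n) ≤
      dyadicContent s (E n) + ∑ i ∈ Finset.range (n + 1), (η i : ℝ≥0∞) := by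
    intro n
    induction n with
    | zero => simpa using! (hlt 0).le
    | succ n ih =>
      have h1 := familyWeight_maximalCells_add_le s (V n) (A (n + 1))
      rw [← hV] at h1
      have h2 : dyadicContent s (E n) ≤ dyadicContent s
          ((⋃ d ∈ V n, dyadicCell d) ∩ ⋃ d ∈ A (n + 1), dyadicCell d) :=
        dyadicContent_mono s (subset_inter (hVcov n) ((hE n.le_succ).trans (hcov (n + 1))))
      have h3 : familyWeight s (V (n + 1)) + dyadicContent s (E n) ≤
          (dyadicContent s (E (n + 1)) + ∑ i ∈ Finset.range (n + 1 + 1), (η i : ℝ≥0∞)) +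
            dyadicContent s (E n) := by
        calc _ ≤ familyWeight s (V n) + familyWeight s (A (n + 1)) :=
              (add_le_add le_rfl h2).trans h1
          _ ≤ (dyadicContent s (E n) + ∑ i ∈ Finset.range (n + 1), (η i : ℝ≥0∞)) +
              (dyadicContent s (E (n + 1)) + η (n + 1)) := add_le_add ih (hlt _).le
          _ = _ := by rw [Finset.sum_range_succ _ (n + 1)]; ring
      exact (ENNReal.add_le_add_iff_right (hEfin n)).1 h3
  have hstep : ∀ m k, k ∈ V m → k ∈ maximalCells (⋃ n, V n) → k ∈ V (m + 1) := by
    intro m d hd hmax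
    rw [hV]
    refine ⟨Or.inl hd, fun e he hsub => ?_⟩
    by_cases hne : (dyadicCell d).Nonempty
    · obtain ⟨x, hx⟩ := hne
      obtain ⟨e', he', hxe', hle⟩ := exists_maximalCell he (hsub hx)
      rw [← hV] at he'
      by_contra hlt'
      exact absurd (hmax.2 e' (mem_iUnion.2 ⟨m + 1, he'⟩)
        (dyadicCell_subset hxe' hx (by omega))) (by omega)
    · exact absurd ⟨(d.2 : ℝ) / 2 ^ d.1, by simp [dyadicCell]⟩ hne
  have hsub : maximalCells (⋃ n, V n) ⊆ ⋃ m, ⋂ k, V (m + k) := by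
    intro d hd
    obtain ⟨m, hm⟩ := mem_iUnion.1 hd.1
    refine mem_iUnion.2 ⟨m, mem_iInter.2 fun k => ?_⟩
    induction k with
    | zero => exact hm
    | succ k ih => exact hstep _ _ ih hd
  have hmono : Monotone fun m => ⋂ k, V (m + k) := by
    refine monotone_nat_of_le_succ fun m d hd => mem_iInter.2 fun k => ?_
    have := mem_iInter.1 hd (1 + k)
    rwa [← add_assoc] at this
  calc dyadicContent s (⋃ n, E n) ≤ familyWeight s (maximalCells (⋃ n, V n)) := by
        refine dyadicContent_le ?_
        rw [iUnion_maximalCells, biUnion_iUnion]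
        exact iUnion_mono hVcov
    _ ≤ familyWeight s (⋃ m, ⋂ k, V (m + k)) := measure_mono hsub
    _ = ⨆ m, familyWeight s (⋂ k, V (m + k)) := hmono.measure_iUnion
    _ ≤ (⨆ n, dyadicContent s (E n)) + ε := by
        refine iSup_le fun m => ?_
        calc familyWeight s (⋂ k, V (m + k)) ≤ familyWeight s (V m) :=
              measure_mono (iInter_subset (fun k => V (m + k)) 0)
          _ ≤ dyadicContent s (E m) + ∑ i ∈ Finset.range (m + 1), (η i : ℝ≥0∞) := hVw m
          _ ≤ _ := add_le_add (le_iSup (fun n => dyadicContent s (E n)) m)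
              ((ENNReal.sum_le_tsum _).trans hηsum.le)

theorem dyadicContent_Ico_le (s x : ℝ) (n : ℕ) :
    dyadicContent s (Ico x (x + (1 / 2) ^ n)) ≤ 2 * levelWeight s n := by
  calc _ ≤ familyWeight s ({(n, ⌊x * 2 ^ n⌋)} ∪ {(n, ⌊x * 2 ^ n⌋ + 1)}) := by
        refine dyadicContent_le fun y hy => ?_
        have hp : (0 : ℝ) < 2 ^ n := by positivity
        have h1 : x * 2 ^ n ≤ y * 2 ^ n := by gcongr; exact hy.1
        have h2 : y * 2 ^ n < x * 2 ^ n + 1 := by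
          calc y * 2 ^ n < (x + (1 / 2) ^ n) * 2 ^ n := by gcongr; exact hy.2
            _ = x * 2 ^ n + 1 := by rw [add_mul, ← mul_pow]; norm_num
        have h3 : ⌊x * 2 ^ n⌋ ≤ ⌊y * 2 ^ n⌋ := Int.floor_le_floor h1
        have h4 : ⌊y * 2 ^ n⌋ ≤ ⌊x * 2 ^ n⌋ + 1 := by
          rw [← Int.floor_add_one]; exact Int.floor_le_floor h2.le
        simp only [mem_iUnion, dyadicCell, mem_ofPred_eq]
        rcases h3.eq_or_lt with h | h
        · exact ⟨(n, _), Or.inl rfl, h.symm⟩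
        · exact ⟨(n, _), Or.inr rfl, le_antisymm h4 h⟩
    _ ≤ _ := (measure_union_le _ _).trans (by
        rw [familyWeight_singleton, familyWeight_singleton, two_mul])

/-- A covering by half-open dyadic intervals extends to an open covering at the cost of a
factor `2`: the left neighbour of each interval is added. -/
theorem exists_isOpen_dyadicContent_le {s : ℝ} {K : Set ℝ} {c : ℝ≥0∞}
    (h : dyadicContent s K < c) : ∃ U, IsOpen U ∧ K ⊆ U ∧ dyadicContent s U ≤ 2 * c := by
  obtain ⟨A, hA, hAc⟩ := exists_family_lt h
  let B : Set (ℕ × ℤ) := (fun d : ℕ × ℤ => (d.1, d.2 - 1)) '' A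
  have hB : familyWeight s B ≤ familyWeight s A := by
    have hinj : InjOn (fun d : ℕ × ℤ => (d.1, d.2 - 1)) A := by
      rintro ⟨a, b⟩ - ⟨a', b'⟩ - hab
      simp only [Prod.mk.injEq] at hab ⊢
      exact ⟨hab.1, by omega⟩
    rw [familyWeight_eq_tsum, familyWeight_eq_tsum]
    exact (tsum_image (fun d : ℕ × ℤ => levelWeight s d.1) hinj).le
  refine ⟨⋃ d ∈ A, Ioo ((d.2 - 1) / 2 ^ d.1 : ℝ) ((d.2 + 1) / 2 ^ d.1),
    isOpen_biUnion fun _ _ => isOpen_Ioo, fun x hx => ?_, ?_⟩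
  · obtain ⟨d, hd, hxd⟩ := mem_iUnion₂.1 (hA hx)
    have hp : (0 : ℝ) < 2 ^ d.1 := by positivity
    have h := Int.floor_eq_iff.1 hxd
    refine mem_iUnion₂.2 ⟨d, hd, ?_, ?_⟩
    · rw [div_lt_iff₀ hp]; linarith
    · rw [lt_div_iff₀ hp]; exact h.2
  · calc _ ≤ familyWeight s (A ∪ B) := by
          refine dyadicContent_le fun x hx => ?_
          obtain ⟨d, hd, hxd⟩ := mem_iUnion₂.1 hx
          have hp : (0 : ℝ) < 2 ^ d.1 := by positivity
          rw [mem_Ioo, div_lt_iff₀ hp, lt_div_iff₀ hp] at hxd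
          by_cases hle : (d.2 : ℝ) ≤ x * 2 ^ d.1
          · exact mem_iUnion₂.2 ⟨d, Or.inl hd, Int.floor_eq_iff.2 ⟨hle, hxd.2⟩⟩
          · refine mem_iUnion₂.2 ⟨(d.1, d.2 - 1), Or.inr ⟨d, hd, rfl⟩, Int.floor_eq_iff.2 ?_⟩
            push_cast
            exact ⟨hxd.1.le, by linarith [not_le.1 hle]⟩
      _ ≤ familyWeight s A + familyWeight s B := measure_union_le _ _
      _ ≤ 2 * c := by rw [two_mul]; exact add_le_add hAc.le (hB.trans hAc.le)

theorem levelWeight_anti {s : ℝ} (hs : 0 ≤ s) : Antitone (levelWeight s) := by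
  intro m n h
  refine ENNReal.ofReal_le_ofReal (Real.rpow_le_rpow_of_exponent_le (by norm_num) ?_)
  have : (m : ℝ) ≤ n := by exact_mod_cast h
  nlinarith

theorem tendsto_levelWeight {s : ℝ} (hs : 0 < s) :
    Tendsto (levelWeight s) atTop (𝓝 0) := by
  have h : Tendsto (fun n : ℕ => ((2 : ℝ) ^ (-s)) ^ n) atTop (𝓝 0) :=
    tendsto_pow_atTop_nhds_zero_of_lt_one (by positivity)
      (Real.rpow_lt_one_of_one_lt_of_neg (by norm_num) (by linarith))
  have h2 := ENNReal.tendsto_ofReal h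
  rw [ENNReal.ofReal_zero] at h2
  refine h2.congr fun n => ?_
  rw [levelWeight, ← Real.rpow_natCast, ← Real.rpow_mul (by norm_num)]
  congr 2; ring

theorem levelWeight_pos (s : ℝ) (n : ℕ) : 0 < levelWeight s n :=
  ENNReal.ofReal_pos.2 (by positivity)

theorem ediam_dyadicCell_le (d : ℕ × ℤ) :
    Metric.ediam (dyadicCell d) ≤ ENNReal.ofReal ((1 / 2 : ℝ) ^ d.1) := by
  refine (Metric.ediam_mono (dyadicCell_subset_Ico d)).trans (le_of_eq ?_)
  rw [Real.ediam_Ico]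
  congr 1; ring

theorem dyadicContent_pos {s : ℝ} (hs : 0 < s) {F : Set ℝ}
    (hF : 0 < Measure.hausdorffMeasure s F) : 0 < dyadicContent s F := by
  by_contra hzero
  have hzero : dyadicContent s F = 0 := by simpa using hzero
  have hA : ∀ n : ℕ, ∃ A : Set (ℕ × ℤ), F ⊆ ⋃ d ∈ A, dyadicCell d ∧
      familyWeight s A < levelWeight s n := fun n =>
    exists_family_lt (hzero ▸ levelWeight_pos s n)
  choose A hcov hlt using hA
  have hlev : ∀ n, ∀ d ∈ A n, n ≤ d.1 := by
    intro n d hd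
    by_contra hcon
    have h1 : levelWeight s d.1 ≤ familyWeight s (A n) := by
      rw [← familyWeight_singleton]; exact measure_mono (by simpa using hd)
    have h2 := levelWeight_anti hs.le (not_le.1 hcon).le
    exact absurd (h2.trans h1) (not_le.2 (hlt n))
  have hr : Tendsto (fun n : ℕ => ENNReal.ofReal ((1 / 2 : ℝ) ^ n)) atTop (𝓝 0) := by
    have h2 := ENNReal.tendsto_ofReal
      (tendsto_pow_atTop_nhds_zero_of_lt_one (r := (1 / 2 : ℝ)) (by norm_num) (by norm_num))
    rwa [ENNReal.ofReal_zero] at h2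
  have key := Measure.hausdorffMeasure_le_liminf_tsum (ι := fun n => A n) s F _ hr
    (fun n d => dyadicCell d)
    (Eventually.of_forall fun n d => (ediam_dyadicCell_le d).trans
      (ENNReal.ofReal_le_ofReal (pow_le_pow_of_le_one (by norm_num) (by norm_num)
        (hlev n d d.2))))
    (Eventually.of_forall fun n => by simpa [iUnion_subtype] using hcov n)
  have hle : ∀ n, ∑' d : A n, Metric.ediam (dyadicCell d) ^ s ≤ levelWeight s n := by
    intro n
    refine le_trans ?_ (hlt n).le
    rw [familyWeight_eq_tsum]
    refine ENNReal.tsum_le_tsum fun d => ?_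
    calc _ ≤ ENNReal.ofReal ((1 / 2 : ℝ) ^ (d : ℕ × ℤ).1) ^ s :=
          ENNReal.rpow_le_rpow (ediam_dyadicCell_le d) hs.le
      _ = levelWeight s (d : ℕ × ℤ).1 := by
          rw [ENNReal.ofReal_rpow_of_nonneg (by positivity) hs.le, levelWeight]
          congr 1
          rw [one_div, inv_pow, ← Real.rpow_natCast, ← Real.rpow_neg (by norm_num),
            ← Real.rpow_mul (by norm_num)]
          congr 1; ring
  have hlim : Tendsto (fun n => ∑' d : A n, Metric.ediam (dyadicCell d) ^ s) atTop (𝓝 0) :=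
    tendsto_of_tendsto_of_tendsto_of_le_of_le tendsto_const_nhds (tendsto_levelWeight hs)
      (fun _ => zero_le) hle
  rw [hlim.liminf_eq] at key
  exact absurd hF (not_lt.2 key)

/-! ### Frostman measures on Borel sets -/

theorem isCompact_natBox (b : ℕ → ℕ) : IsCompact {x : ℕ → ℕ | ∀ i, x i ≤ b i} := by
  have := isCompact_univ_pi (s := fun i => Iic (b i)) fun i => (finite_Iic (b i)).isCompact
  convert this using 1
  ext x; simp [Pi.le_def]

/-- An open set that contains a compact box in the Baire space contains the cylinder set obtained
by keeping only finitely many of the constraints that define the box. -/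
theorem exists_cylinder_subset_of_box_subset (b : ℕ → ℕ) {V : Set (ℕ → ℕ)} (hV : IsOpen V)
    (h : {x | ∀ i, x i ≤ b i} ⊆ V) : ∃ k, {x | ∀ i < k, x i ≤ b i} ⊆ V := by
  have hloc : ∀ x ∈ V, ∃ k, PiNat.cylinder x k ⊆ V := by
    intro x hx
    obtain ⟨_, ⟨y, k, rfl⟩, hxy, hsub⟩ :=
      (PiNat.isTopologicalBasis_cylinders (fun _ => ℕ)).exists_subset_of_mem_open hx hV
    exact ⟨k, by rwa [PiNat.mem_cylinder_iff_eq.1 hxy]⟩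
  choose! k hk using hloc
  obtain ⟨t, ht, hcov⟩ := (isCompact_natBox b).elim_nhds_subcover (fun x => PiNat.cylinder x (k x))
    fun x _ => (PiNat.isOpen_cylinder _ x _).mem_nhds (PiNat.self_mem_cylinder x _)
  refine ⟨t.sup k, fun x hx => ?_⟩
  have hy : (fun i => min (x i) (b i)) ∈ {x : ℕ → ℕ | ∀ i, x i ≤ b i} := fun i => min_le_right _ _
  obtain ⟨z, hz, hyz⟩ := mem_iUnion₂.1 (hcov hy)
  refine hk z (h (ht z hz)) (PiNat.mem_cylinder_iff.2 fun i hi => ?_)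
  rw [← PiNat.mem_cylinder_iff.1 hyz i hi, min_eq_left (hx i (hi.trans_le (Finset.le_sup hz)))]

/-- Choquet's capacitability argument: for a monotone set function that is continuous from below
along arbitrary increasing sequences, an analytic set has compact subsets all of whose open
neighbourhoods are almost as large as the set. -/
theorem exists_isCompact_le_of_isOpen {X : Type*} [TopologicalSpace X] {Φ : Set X → ℝ≥0∞}
    (hmono : ∀ {E E' : Set X}, E ⊆ E' → Φ E ≤ Φ E')
    (hcont : ∀ {E : ℕ → Set X}, Monotone E → Φ (⋃ n, E n) ≤ ⨆ n, Φ (E n))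
    {F : Set X} (hF : AnalyticSet F) {c : ℝ≥0∞} (hc : c < Φ F) :
    ∃ K ⊆ F, IsCompact K ∧ ∀ U, IsOpen U → K ⊆ U → c ≤ Φ U := by
  rw [AnalyticSet] at hF
  rcases hF with rfl | ⟨f, hf, rfl⟩
  · exact ⟨∅, Subset.rfl, isCompact_empty, fun U _ hU => hc.le.trans (hmono hU)⟩
  have hstep : ∀ (T : Set (ℕ → ℕ)) (k : ℕ), c < Φ (f '' T) →
      ∃ N, c < Φ (f '' (T ∩ {x | x k ≤ N})) := by
    intro T k hT
    have hm : Monotone fun N : ℕ => f '' (T ∩ {x | x k ≤ N}) := fun M N h =>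
      image_mono (inter_subset_inter_right _ fun x (hx : x k ≤ M) => hx.trans h)
    have hU : ⋃ N : ℕ, f '' (T ∩ {x | x k ≤ N}) = f '' T := by
      rw [← image_iUnion, ← inter_iUnion]
      congr 1
      exact inter_eq_left.2 fun x _ => mem_iUnion.2 ⟨x k, le_refl (x k)⟩
    have := hcont hm
    rw [hU] at this
    exact lt_iSup_iff.1 (hT.trans_le this)
  choose! N hN using hstep
  let T : ℕ → Set (ℕ → ℕ) := fun n => Nat.rec univ (fun k S => S ∩ {x | x k ≤ N S k}) n
  have hT : ∀ k, c < Φ (f '' T k) := by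
    intro k
    induction k with
    | zero => simpa [T] using hc
    | succ k ih => exact hN _ _ ih
  let b : ℕ → ℕ := fun k => N (T k) k
  have hTb : ∀ k, T k = {x | ∀ i < k, x i ≤ b i} := by
    intro k
    induction k with
    | zero => simp [T]
    | succ k ih =>
      have : T (k + 1) = T k ∩ {x | x k ≤ b k} := rfl
      rw [this, ih]
      ext x
      simp only [mem_inter_iff, mem_ofPred_eq, Nat.lt_succ_iff_lt_or_eq]
      constructor
      · rintro ⟨h1, h2⟩ i (hi | rfl)
        exacts [h1 i hi, h2]
      · exact fun h => ⟨fun i hi => h i (Or.inl hi), h k (Or.inr rfl)⟩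
  refine ⟨f '' {x | ∀ i, x i ≤ b i}, image_subset_range _ _, (isCompact_natBox b).image hf, fun U hU hKU => ?_⟩
  obtain ⟨k, hk⟩ := exists_cylinder_subset_of_box_subset b (hU.preimage hf) (image_subset_iff.1 hKU)
  exact (hT k).le.trans (hmono (image_subset_iff.2 (hTb k ▸ hk)))

theorem exists_isCompact_dyadicContent_pos {s : ℝ} (hs : 0 < s) {F : Set ℝ}
    (hF : MeasurableSet F) (hFs : 0 < Measure.hausdorffMeasure s F) :
    ∃ K ⊆ F, IsCompact K ∧ 0 < dyadicContent s K := by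
  obtain ⟨c, hc0, hc⟩ := exists_between (dyadicContent_pos hs hFs)
  obtain ⟨K, hKF, hK, hU⟩ := exists_isCompact_le_of_isOpen (dyadicContent_mono s)
    (dyadicContent_iUnion_le s) hF.analyticSet hc
  refine ⟨K, hKF, hK, pos_of_ne_zero fun h0 => ?_⟩
  have hctop := ne_top_of_lt hc
  have h4 : 0 < c / 4 := ENNReal.div_pos hc0.ne' (by norm_num)
  obtain ⟨U, hUo, hKU, hle⟩ := exists_isOpen_dyadicContent_le (h0 ▸ h4)
  have h1 := (hU U hUo hKU).trans hle
  have h2 : 2 * (c / 4) < c := by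
    have : (2 : ℝ≥0∞) * (c / 4) = c / 2 := by
      rw [← mul_div_assoc, mul_comm, ENNReal.div_eq_div_iff (by norm_num) (by norm_num)
        (by norm_num) (by norm_num)]
      ring
    rw [this]
    exact ENNReal.half_lt_self hc0.ne' hctop
  exact absurd h1 (not_le.2 h2)

/-- Frostman's lemma on the line. For a compact set `K` of positive content, the function
`x ↦ Φ (K ∩ (-∞, x))`, where `Φ` is the content, is increasing and by subadditivity of `Φ` its
increments are bounded by `Φ (K ∩ [x, y))`; hence its Stieltjes measure lives on `K` and has the
required modulus of continuity. -/
theorem exists_frostman_measure {s : ℝ} (hs : 0 < s) {F : Set ℝ} (hF : MeasurableSet F)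
    (hFs : 0 < Measure.hausdorffMeasure s F) :
    ∃ μ : Measure ℝ, IsFiniteMeasure μ ∧ μ ≠ 0 ∧ μ Fᶜ = 0 ∧
      ∀ (x : ℝ) (n : ℕ), μ (Icc x (x + (1 / 2) ^ n)) ≤ 2 * levelWeight s n := by
  obtain ⟨K, hKF, hK, hpos⟩ := exists_isCompact_dyadicContent_pos hs hF hFs
  have hlw : ∀ n, 2 * levelWeight s n ≠ ∞ := fun n =>
    ENNReal.mul_ne_top (by norm_num) ENNReal.ofReal_ne_top
  have hIco : ∀ a b : ℝ, dyadicContent s (Ico a b) ≠ ∞ := by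
    intro a b
    have : ∀ n : ℕ, dyadicContent s (Ico a (a + n)) ≠ ∞ := by
      intro n
      induction n with
      | zero => simp [dyadicContent_empty]
      | succ n ih =>
        have h1 := dyadicContent_Ico_le s (a + n) 0
        rw [pow_zero] at h1
        refine ne_top_of_le_ne_top (ENNReal.add_ne_top.2 ⟨ih, ne_top_of_le_ne_top (hlw 0) h1⟩)
          ((dyadicContent_mono s ?_).trans (dyadicContent_union_le s _ _))
        intro x hx
        push_cast at hx
        rcases lt_or_ge x (a + n) with h | h
        · exact Or.inl ⟨hx.1, h⟩
        · exact Or.inr ⟨h, by linarith [hx.2]⟩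
    obtain ⟨n, hn⟩ := exists_nat_ge (b - a)
    exact ne_top_of_le_ne_top (this n)
      (dyadicContent_mono s (Ico_subset_Ico_right (by linarith)))
  obtain ⟨M, hM⟩ := hK.isBounded.subset_ball 0
  have hKM : K ⊆ Ico (-M) M := fun x hx => by
    have := hM hx
    rw [Metric.mem_ball, dist_zero_right, Real.norm_eq_abs, abs_lt] at this
    exact ⟨this.1.le, this.2⟩
  have hKfin : ∀ E : Set ℝ, dyadicContent s (K ∩ E) ≠ ∞ := fun E =>
    ne_top_of_le_ne_top (hIco (-M) M) (dyadicContent_mono s (inter_subset_left.trans hKM))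
  set G : ℝ → ℝ := fun x => (dyadicContent s (K ∩ Iio x)).toReal with hG
  have hGmono : Monotone G := fun x y h => ENNReal.toReal_mono (hKfin _)
    (dyadicContent_mono s (inter_subset_inter_right _ (Iio_subset_Iio h)))
  have hGinc : ∀ x y, x ≤ y → G y - G x ≤ (dyadicContent s (K ∩ Ico x y)).toReal := by
    intro x y h
    rw [sub_le_iff_le_add', ← ENNReal.toReal_add (hKfin _) (hKfin _)]
    refine ENNReal.toReal_mono (ENNReal.add_ne_top.2 ⟨hKfin _, hKfin _⟩) ?_
    rw [← Iio_union_Ico_eq_Iio h, inter_union_distrib_left]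
    exact dyadicContent_union_le s _ _
  have hGn : ∀ (x : ℝ) (n : ℕ), G (x + (1 / 2) ^ n) - G x ≤ (2 * levelWeight s n).toReal :=
    fun x n => (hGinc _ _ (by simp)).trans (ENNReal.toReal_mono (hlw n)
      ((dyadicContent_mono s inter_subset_right).trans (dyadicContent_Ico_le s x n)))
  have hlw0 : Tendsto (fun n => (2 * levelWeight s n).toReal) atTop (𝓝 0) := by
    have h1 : Tendsto (fun n => 2 * levelWeight s n) atTop (𝓝 (2 * 0)) :=
      ENNReal.Tendsto.const_mul (tendsto_levelWeight hs) (Or.inr (by norm_num))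
    rw [mul_zero] at h1
    exact (ENNReal.tendsto_toReal (by norm_num)).comp h1
  have hGcont : Continuous G := by
    refine Metric.continuous_iff.2 fun x ε hε => ?_
    obtain ⟨n, hn⟩ := (hlw0.eventually (gt_mem_nhds hε)).exists
    refine ⟨(1 / 2) ^ n, by positivity, fun y hy => ?_⟩
    rw [Real.dist_eq, abs_lt] at *
    have h1 := hGn x n
    have h2 := hGn y n
    have h3 : G y ≤ G (x + (1 / 2) ^ n) := hGmono (by linarith [hy.2])
    have h4 : G x ≤ G (y + (1 / 2) ^ n) := hGmono (by linarith [hy.1])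
    constructor <;> linarith
  let S : StieltjesFunction ℝ := ⟨G, hGmono, fun x => hGcont.continuousWithinAt⟩
  have hIcc : ∀ a b, S.measure (Icc a b) = ENNReal.ofReal (G b - G a) := by
    intro a b
    rw [StieltjesFunction.measure_Icc]
    congr 2
    exact (hGcont.continuousAt.continuousWithinAt).leftLim_eq
  have hnull : S.measure Kᶜ = 0 := by
    refine measure_null_of_locally_null _ fun x hx => ?_
    obtain ⟨ε, hε, hball⟩ := Metric.isOpen_iff.1 hK.isClosed.isOpen_compl x hx
    refine ⟨Icc (x - ε / 2) (x + ε / 2), mem_nhdsWithin_of_mem_nhds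
      (Icc_mem_nhds (by linarith) (by linarith)), ?_⟩
    rw [hIcc, ENNReal.ofReal_eq_zero]
    refine (hGinc _ _ (by linarith)).trans (le_of_eq ?_)
    have : K ∩ Ico (x - ε / 2) (x + ε / 2) = ∅ := by
      refine eq_empty_of_forall_notMem fun y hy => hball ?_ hy.1
      rw [Metric.mem_ball, Real.dist_eq, abs_lt]
      constructor <;> linarith [hy.2.1, hy.2.2]
    rw [this, dyadicContent_empty, ENNReal.toReal_zero]
  have hGM : G M = (dyadicContent s K).toReal := by
    have : K ∩ Iio M = K := inter_eq_left.2 fun x hx => (hKM hx).2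
    simp only [hG]
    rw [this]
  have hGM' : G (-M) = 0 := by
    have : K ∩ Iio (-M) = ∅ :=
      eq_empty_of_forall_notMem fun y hy => absurd hy.2 (not_lt.2 (hKM hy.1).1)
    simp only [hG]
    rw [this, dyadicContent_empty, ENNReal.toReal_zero]
  refine ⟨S.measure, ?_, ?_, measure_mono_null (compl_subset_compl.2 hKF) hnull, ?_⟩
  · refine S.isFiniteMeasure_of_forall_abs_le (C := (dyadicContent s K).toReal) fun x => ?_
    change |(dyadicContent s (K ∩ Iio x)).toReal| ≤ _
    rw [abs_of_nonneg ENNReal.toReal_nonneg]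
    refine ENNReal.toReal_mono ?_ (dyadicContent_mono s inter_subset_left)
    simpa using hKfin univ
  · intro h0
    have h1 := hIcc (-M) M
    rw [h0, hGM, hGM', sub_zero] at h1
    have h2 : 0 < (dyadicContent s K).toReal :=
      ENNReal.toReal_pos hpos.ne' (by simpa using hKfin univ)
    simp at h1
    linarith
  · intro x n
    rw [hIcc]
    exact ENNReal.ofReal_le_of_le_toReal (hGn x n)

/-! ### Holes of a closed set -/

theorem exists_eq_Ioo_of_mem_holes {E : Set ℝ} (hE : IsClosed E) {U : Set ℝ} (hU : U ∈ holes E) :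
    ∃ u v, u < v ∧ U = Ioo u v ∧ ∀ x ∈ E, x ≤ u ∨ v ≤ x := by
  obtain ⟨⟨x, hx, rfl⟩, hb⟩ := hU
  set U := connectedComponentIn Eᶜ x
  have hxU : x ∈ U := mem_connectedComponentIn hx
  have hconn : IsConnected U := ⟨⟨x, hxU⟩, isPreconnected_connectedComponentIn⟩
  have hopen : IsOpen U := hE.isOpen_compl.connectedComponentIn
  have heq : U = Ioo (sInf U) (sSup U) := by
    refine Subset.antisymm ?_ (hconn.Ioo_csInf_csSup_subset hb.bddBelow hb.bddAbove)
    rw [← interior_Icc]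
    exact interior_maximal (subset_Icc_csInf_csSup hb.bddBelow hb.bddAbove) hopen
  refine ⟨sInf U, sSup U, ?_, heq, fun y hy => ?_⟩
  · rw [heq] at hxU; exact hxU.1.trans hxU.2
  · by_contra! hcon
    have : y ∈ U := by rw [heq]; exact hcon
    exact connectedComponentIn_subset _ _ this hy

theorem Ioo_mem_holes {E : Set ℝ} {u v : ℝ} (huv : u < v) (hu : u ∈ E) (hv : v ∈ E)
    (hE : ∀ x ∈ E, x ≤ u ∨ v ≤ x) : Ioo u v ∈ holes E := by
  have hsub : Ioo u v ⊆ Eᶜ := fun x hx hxE => by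
    rcases hE x hxE with h | h
    exacts [absurd hx.1 (not_lt.2 h), absurd hx.2 (not_lt.2 h)]
  obtain ⟨x, hx⟩ := nonempty_Ioo.2 huv
  refine ⟨⟨x, hsub hx, ?_⟩, Metric.isBounded_Ioo u v⟩
  refine Subset.antisymm (isPreconnected_Ioo.subset_connectedComponentIn hx hsub) fun y hy => ?_
  have hord : OrdConnected (connectedComponentIn Eᶜ x) :=
    isPreconnected_connectedComponentIn.ordConnected
  have hxx : x ∈ connectedComponentIn Eᶜ x := mem_connectedComponentIn (hsub hx)
  by_contra hcon
  rcases le_or_gt y u with h | h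
  · exact connectedComponentIn_subset _ _ (hord.out hy hxx ⟨h, hx.1.le⟩) hu
  · have h' : v ≤ y := not_lt.1 fun h' => hcon ⟨h, h'⟩
    exact connectedComponentIn_subset _ _ (hord.out hxx hy ⟨hx.2.le, h'⟩) hv

theorem pairwiseDisjoint_holes (E : Set ℝ) : (holes E).PairwiseDisjoint id := by
  rintro U ⟨⟨x, hx, rfl⟩, -⟩ V ⟨⟨y, hy, rfl⟩, -⟩ hne
  refine disjoint_left.2 fun z hzx hzy => hne ?_
  rw [connectedComponentIn_eq hzx, connectedComponentIn_eq hzy]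

theorem countable_holes {E : Set ℝ} (hE : IsClosed E) : (holes E).Countable := by
  refine (pairwiseDisjoint_holes E).countable_of_isOpen ?_ ?_
  · rintro U ⟨⟨x, hx, rfl⟩, -⟩
    exact hE.isOpen_compl.connectedComponentIn
  · rintro U ⟨⟨x, hx, rfl⟩, -⟩
    exact ⟨x, mem_connectedComponentIn hx⟩

theorem hole_subset_Ioo {E : Set ℝ} (hE : IsClosed E) {a b : ℝ} (ha : a ∈ E) (hb : b ∈ E)
    (hEab : E ⊆ Icc a b) {U : Set ℝ} (hU : U ∈ holes E) : U ⊆ Ioo a b := by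
  obtain ⟨u, v, huv, hUeq, hEuv⟩ := exists_eq_Ioo_of_mem_holes hE hU
  obtain ⟨⟨x, hx, hUx⟩, hbdd⟩ := hU
  have hxU : x ∈ U := hUx ▸ mem_connectedComponentIn hx
  rw [hUeq] at hxU
  rw [hUeq] at hbdd hUx ⊢
  have h1 : a ≤ u := by
    refine (hEuv a ha).resolve_right fun h => ?_
    have hs : Iio a ⊆ Ioo u v := by
      rw [hUx]
      exact isPreconnected_Iio.subset_connectedComponentIn (hxU.2.trans_le h)
        fun y hy hyE => absurd hy (not_lt.2 (hEab hyE).1)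
    have := hs (show u - 1 ∈ Iio a by rw [mem_Iio]; linarith)
    linarith [this.1]
  have h2 : v ≤ b := by
    refine (hEuv b hb).resolve_left fun h => ?_
    have hs : Ioi b ⊆ Ioo u v := by
      rw [hUx]
      exact isPreconnected_Ioi.subset_connectedComponentIn (h.trans_lt hxU.1)
        fun y hy hyE => absurd hy (not_lt.2 (hEab hyE).2)
    have := hs (show v + 1 ∈ Ioi b by rw [mem_Ioi]; linarith)
    linarith [this.2]
  exact Ioo_subset_Ioo h1 h2

theorem diam_Ioo_eq {u v : ℝ} (h : u < v) : Metric.diam (Ioo u v) = v - u := by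
  rw [Real.diam_Ioo h.le]

theorem summable_diam_holes {E : Set ℝ} (hE : IsClosed E) {a b : ℝ} (ha : a ∈ E) (hb : b ∈ E)
    (hEab : E ⊆ Icc a b) : Summable fun U : holes E => Metric.diam (U : Set ℝ) := by
  have hvol : ∀ U : holes E, volume (U : Set ℝ) = ENNReal.ofReal (Metric.diam (U : Set ℝ)) := by
    rintro ⟨U, hU⟩
    obtain ⟨u, v, huv, rfl, -⟩ := exists_eq_Ioo_of_mem_holes hE hU
    rw [diam_Ioo_eq huv, Real.volume_Ioo]
  have hsum : ∑' U : holes E, ENNReal.ofReal (Metric.diam (U : Set ℝ)) ≠ ∞ := by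
    refine ne_top_of_le_ne_top (b := volume (Ioo a b)) (by simp) ?_
    simp_rw [← hvol]
    have := (countable_holes hE).to_subtype
    rw [← measure_iUnion]
    · exact measure_mono (iUnion_subset fun U => hole_subset_Ioo hE ha hb hEab U.2)
    · intro U V hUV
      exact pairwiseDisjoint_holes E U.2 V.2 (fun h => hUV (Subtype.ext h))
    · rintro ⟨U, hU⟩
      obtain ⟨u, v, huv, rfl, -⟩ := exists_eq_Ioo_of_mem_holes hE hU
      exact measurableSet_Ioo
  refine (ENNReal.summable_toReal hsum).congr fun U => ?_
  rw [ENNReal.toReal_ofReal Metric.diam_nonneg]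

/-! ### The Cantor set -/

section CantorSet

/-- The common length of the intervals of stage `K`. -/
noncomputable def stageLength (c : ℕ → ℝ) (K : ℕ) : ℝ := ∏ k ∈ Finset.range K, c k

/-- The left endpoints of the intervals of stage `K`, numbered from left to right by
`j < 2 ^ K`. -/
noncomputable def leftEndpoint (c : ℕ → ℝ) : ℕ → ℕ → ℝ
  | 0, _ => 0
  | K + 1, j => leftEndpoint c K (j / 2) +
      if j % 2 = 1 then stageLength c K - stageLength c (K + 1) else 0

/-- The length of the gaps that are created in the step from stage `K` to stage `K + 1`. -/
noncomputable def gapLength (c : ℕ → ℝ) (K : ℕ) : ℝ := stageLength c K - 2 * stageLength c (K + 1)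

variable {c : ℕ → ℝ}

theorem stageLength_succ (c : ℕ → ℝ) (K : ℕ) :
    stageLength c (K + 1) = stageLength c K * c K := by
  simp [stageLength, Finset.prod_range_succ]

theorem stageLength_pos (h0 : ∀ k, 0 < c k) (K : ℕ) : 0 < stageLength c K :=
  Finset.prod_pos fun k _ => h0 k

theorem stageLength_le (h0 : ∀ k, 0 < c k) (h1 : ∀ k, c k < 1 / 2) (K : ℕ) :
    stageLength c K ≤ (1 / 2) ^ K := by
  simpa [stageLength] using
    Finset.prod_le_prod (s := Finset.range K) (fun k _ => (h0 k).le) fun k _ => (h1 k).le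

theorem gapLength_eq (c : ℕ → ℝ) (K : ℕ) :
    gapLength c K = (1 - 2 * c K) * stageLength c K := by
  rw [gapLength, stageLength_succ]; ring

theorem gapLength_pos (h0 : ∀ k, 0 < c k) (h1 : ∀ k, c k < 1 / 2) (K : ℕ) : 0 < gapLength c K := by
  rw [gapLength_eq]
  exact mul_pos (by linarith [h1 K]) (stageLength_pos h0 K)

theorem gapLength_anti (h0 : ∀ k, 0 < c k) (h1 : ∀ k, c k < 1 / 2) (hm : Monotone c) (K : ℕ) :
    gapLength c (K + 1) ≤ gapLength c K := by
  rw [gapLength_eq, gapLength_eq, stageLength_succ]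
  have h2 := hm K.le_succ
  have h3 := stageLength_pos h0 K
  have : stageLength c K * c K ≤ stageLength c K := by nlinarith [h1 K]
  exact mul_le_mul (by linarith) this (mul_pos h3 (h0 K)).le (by linarith [h1 K])

theorem leftEndpoint_two_mul (c : ℕ → ℝ) (K j : ℕ) :
    leftEndpoint c (K + 1) (2 * j) = leftEndpoint c K j := by
  simp [leftEndpoint]

theorem leftEndpoint_two_mul_add_one (c : ℕ → ℝ) (K j : ℕ) :
    leftEndpoint c (K + 1) (2 * j + 1) =
      leftEndpoint c K j + (stageLength c K - stageLength c (K + 1)) := by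
  have h1 : (2 * j + 1) / 2 = j := by omega
  have h2 : (2 * j + 1) % 2 = 1 := by omega
  rw [leftEndpoint, h1, if_pos h2]

theorem mem_cantorIntervals (c : ℕ → ℝ) (K : ℕ) (I : ℝ × ℝ) :
    I ∈ cantorIntervals c K ↔
      ∃ j < 2 ^ K, I = (leftEndpoint c K j, leftEndpoint c K j + stageLength c K) := by
  induction K generalizing I with
  | zero => simp [cantorIntervals, leftEndpoint, stageLength]
  | succ K ih =>
    simp only [cantorIntervals, mem_iUnion, mem_insert_iff, mem_singleton_iff, exists_prop, ih]
    constructor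
    · rintro ⟨_, ⟨j, hj, rfl⟩, rfl | rfl⟩
      · refine ⟨2 * j, by rw [pow_succ]; omega, ?_⟩
        rw [leftEndpoint_two_mul, stageLength_succ]
        ext <;> simp; ring
      · refine ⟨2 * j + 1, by rw [pow_succ]; omega, ?_⟩
        rw [leftEndpoint_two_mul_add_one, stageLength_succ]
        ext <;> simp <;> ring
    · rintro ⟨j, hj, rfl⟩
      rw [pow_succ] at hj
      refine ⟨_, ⟨j / 2, by omega, rfl⟩, ?_⟩
      rcases Nat.mod_two_eq_zero_or_one j with h | h
      · left
        have : j = 2 * (j / 2) := by omega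
        conv_lhs => rw [this, leftEndpoint_two_mul, stageLength_succ]
        ext <;> simp; ring
      · right
        have : j = 2 * (j / 2) + 1 := by omega
        conv_lhs => rw [this, leftEndpoint_two_mul_add_one, stageLength_succ]
        ext <;> simp <;> ring

theorem cantorStage_eq (c : ℕ → ℝ) (K : ℕ) :
    cantorStage c K = ⋃ j ∈ Finset.range (2 ^ K),
      Icc (leftEndpoint c K j) (leftEndpoint c K j + stageLength c K) := by
  ext x
  simp only [cantorStage, mem_iUnion, mem_cantorIntervals, exists_prop, Finset.mem_range]
  constructor
  · rintro ⟨_, ⟨j, hj, rfl⟩, hx⟩; exact ⟨j, hj, hx⟩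
  · rintro ⟨j, hj, hx⟩; exact ⟨_, ⟨j, hj, rfl⟩, hx⟩

theorem mem_cantorStage {K : ℕ} {x : ℝ} : x ∈ cantorStage c K ↔
    ∃ j < 2 ^ K, x ∈ Icc (leftEndpoint c K j) (leftEndpoint c K j + stageLength c K) := by
  simp only [cantorStage_eq, mem_iUnion, Finset.mem_range, exists_prop]

theorem isClosed_cantorStage (c : ℕ → ℝ) (K : ℕ) : IsClosed (cantorStage c K) := by
  rw [cantorStage_eq]
  exact isClosed_biUnion_finset fun _ _ => isClosed_Icc

theorem isClosed_cantorSet (c : ℕ → ℝ) : IsClosed (cantorSet c) :=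
  isClosed_iInter fun K => isClosed_cantorStage c K

theorem cantorStage_anti (h0 : ∀ k, 0 < c k) (h1 : ∀ k, c k < 1 / 2) :
    Antitone (cantorStage c) := by
  refine antitone_nat_of_succ_le fun K x hx => ?_
  obtain ⟨j, hj, hx⟩ := mem_cantorStage.1 hx
  rw [pow_succ] at hj
  refine mem_cantorStage.2 ⟨j / 2, by omega, ?_⟩
  have hL := gapLength_pos h0 h1 K
  have hL' := stageLength_pos h0 (K + 1)
  rw [gapLength] at hL
  rcases Nat.mod_two_eq_zero_or_one j with h | h
  · have : j = 2 * (j / 2) := by omega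
    rw [this, leftEndpoint_two_mul] at hx
    exact ⟨hx.1, by linarith [hx.2]⟩
  · have : j = 2 * (j / 2) + 1 := by omega
    rw [this, leftEndpoint_two_mul_add_one] at hx
    exact ⟨by linarith [hx.1], by linarith [hx.2]⟩

theorem leftEndpoint_mem (h0 : ∀ k, 0 < c k) (h1 : ∀ k, c k < 1 / 2) {K j : ℕ} (hj : j < 2 ^ K) :
    leftEndpoint c K j ∈ cantorSet c ∧ leftEndpoint c K j + stageLength c K ∈ cantorSet c := by
  have key : ∀ n K j, j < 2 ^ K → leftEndpoint c K j ∈ cantorStage c (K + n) ∧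
      leftEndpoint c K j + stageLength c K ∈ cantorStage c (K + n) := by
    intro n
    induction n with
    | zero =>
      intro K j hj
      have := (stageLength_pos h0 K).le
      simp only [add_zero]
      exact ⟨mem_cantorStage.2 ⟨j, hj, le_rfl, by linarith⟩,
        mem_cantorStage.2 ⟨j, hj, by linarith, le_rfl⟩⟩
    | succ n ih =>
      intro K j hj
      have e : K + (n + 1) = K + 1 + n := by ring
      rw [e]
      constructor
      · rw [← leftEndpoint_two_mul]
        exact (ih (K + 1) (2 * j) (by rw [pow_succ]; omega)).1
      · have := (ih (K + 1) (2 * j + 1) (by rw [pow_succ]; omega)).2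
        rw [leftEndpoint_two_mul_add_one] at this
        convert this using 1; ring
  constructor <;> refine mem_iInter.2 fun n => cantorStage_anti h0 h1 (Nat.le_add_left n K) ?_
  exacts [(key n K j hj).1, (key n K j hj).2]

theorem cantorSet_subset_Icc (c : ℕ → ℝ) : cantorSet c ⊆ Icc 0 1 := by
  intro x hx
  obtain ⟨j, hj, hx⟩ := mem_cantorStage.1 (mem_iInter.1 hx 0)
  simpa [leftEndpoint, stageLength] using hx

theorem zero_mem_cantorSet (h0 : ∀ k, 0 < c k) (h1 : ∀ k, c k < 1 / 2) : 0 ∈ cantorSet c :=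
  (leftEndpoint_mem h0 h1 (K := 0) (j := 0) (by norm_num)).1

theorem one_mem_cantorSet (h0 : ∀ k, 0 < c k) (h1 : ∀ k, c k < 1 / 2) : 1 ∈ cantorSet c := by
  simpa [leftEndpoint, stageLength] using
    (leftEndpoint_mem h0 h1 (K := 0) (j := 0) (by norm_num)).2

/-- Consecutive intervals of stage `K + 1` are at least as far apart as the shortest gaps made so
far, which are those of the last step because the gap lengths decrease. -/
theorem gapLength_le (h0 : ∀ k, 0 < c k) (h1 : ∀ k, c k < 1 / 2) (hm : Monotone c) (K : ℕ) :
    ∀ j, j + 1 < 2 ^ (K + 1) → leftEndpoint c (K + 1) j + stageLength c (K + 1) + gapLength c K ≤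
      leftEndpoint c (K + 1) (j + 1) := by
  have heven : ∀ K i, leftEndpoint c (K + 1) (2 * i) + stageLength c (K + 1) + gapLength c K ≤
      leftEndpoint c (K + 1) (2 * i + 1) := by
    intro K i
    rw [leftEndpoint_two_mul, leftEndpoint_two_mul_add_one, gapLength]
    linarith
  induction K with
  | zero =>
    intro j hj
    obtain rfl : j = 2 * 0 := by omega
    exact heven 0 0
  | succ K ih =>
    intro j hj
    rw [pow_succ] at hj
    rcases Nat.mod_two_eq_zero_or_one j with h | h
    · have : j = 2 * (j / 2) := by omega
      rw [this]; exact heven _ _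
    · have e1 : j = 2 * (j / 2) + 1 := by omega
      have e2 : j + 1 = 2 * (j / 2 + 1) := by omega
      have := ih (j / 2) (by omega)
      rw [e2, leftEndpoint_two_mul]
      nth_rewrite 1 [e1]
      rw [leftEndpoint_two_mul_add_one]
      have := gapLength_anti h0 h1 hm K
      linarith

theorem leftEndpoint_add_lt (h0 : ∀ k, 0 < c k) (h1 : ∀ k, c k < 1 / 2) (hm : Monotone c)
    {K i j : ℕ} (hij : i < j) (hj : j < 2 ^ K) :
    leftEndpoint c K i + stageLength c K < leftEndpoint c K j := by
  cases K with
  | zero => simp at hj; omega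
  | succ K =>
    have hg := gapLength_pos h0 h1 K
    have hl := stageLength_pos h0 (K + 1)
    induction j, hij using Nat.le_induction with
    | base => linarith [gapLength_le h0 h1 hm K i hj]
    | succ j hij ih => linarith [gapLength_le h0 h1 hm K j hj, ih (by omega)]

/-- The gap between the intervals of stage `K` with numbers `l` and `l + 1`. -/
noncomputable def cantorHole (c : ℕ → ℝ) (K l : ℕ) : Set ℝ :=
  Ioo (leftEndpoint c K l + stageLength c K) (leftEndpoint c K (l + 1))

/-- The number of the interval of stage `K` that contains the point `x` of the Cantor set. It is
defined as a counting function, which makes sense for all real `x` and is measurable. -/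
noncomputable def cantorIndex (c : ℕ → ℝ) (K : ℕ) (x : ℝ) : ℕ :=
  ∑ l ∈ Finset.range (2 ^ K - 1), (Ici (leftEndpoint c K (l + 1))).indicator 1 x

theorem measurable_cantorIndex (c : ℕ → ℝ) (K : ℕ) : Measurable (cantorIndex c K) := by
  unfold cantorIndex
  refine Finset.measurable_sum _ fun l _ => ?_
  exact measurable_one.indicator measurableSet_Ici

theorem le_leftEndpoint_iff (h0 : ∀ k, 0 < c k) (h1 : ∀ k, c k < 1 / 2) (hm : Monotone c)
    {K i l : ℕ} {x : ℝ} (hi : i < 2 ^ K) (hl : l < 2 ^ K)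
    (hx : x ∈ Icc (leftEndpoint c K i) (leftEndpoint c K i + stageLength c K)) :
    leftEndpoint c K l ≤ x ↔ l ≤ i := by
  have hL := stageLength_pos h0 K
  constructor
  · intro h
    by_contra! hlt
    linarith [leftEndpoint_add_lt h0 h1 hm hlt hl, hx.2]
  · intro h
    rcases h.eq_or_lt with rfl | h
    · exact hx.1
    · linarith [leftEndpoint_add_lt h0 h1 hm h hi, hx.1]

theorem cantorIndex_eq (h0 : ∀ k, 0 < c k) (h1 : ∀ k, c k < 1 / 2) (hm : Monotone c)
    {K i : ℕ} {x : ℝ} (hi : i < 2 ^ K)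
    (hx : x ∈ Icc (leftEndpoint c K i) (leftEndpoint c K i + stageLength c K)) :
    cantorIndex c K x = i := by
  have : ∀ l ∈ Finset.range (2 ^ K - 1),
      (Ici (leftEndpoint c K (l + 1))).indicator (1 : ℝ → ℕ) x = if l < i then 1 else 0 := by
    intro l hl
    have hl' := Finset.mem_range.1 hl
    simp only [indicator, mem_Ici, Pi.one_apply,
      le_leftEndpoint_iff h0 h1 hm hi (by omega : l + 1 < 2 ^ K) hx, Nat.succ_le_iff]
  rw [cantorIndex, Finset.sum_congr rfl this, Finset.sum_boole]
  have e : {l ∈ Finset.range (2 ^ K - 1) | l < i} = Finset.range i := by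
    ext l; simp; omega
  rw [e]; simp

theorem mem_Icc_cantorIndex (h0 : ∀ k, 0 < c k) (h1 : ∀ k, c k < 1 / 2) (hm : Monotone c)
    (K : ℕ) {x : ℝ} (hx : x ∈ cantorSet c) :
    cantorIndex c K x < 2 ^ K ∧ x ∈ Icc (leftEndpoint c K (cantorIndex c K x))
      (leftEndpoint c K (cantorIndex c K x) + stageLength c K) := by
  obtain ⟨j, hj, hx⟩ := mem_cantorStage.1 (mem_iInter.1 hx K)
  rw [cantorIndex_eq h0 h1 hm hj hx]
  exact ⟨hj, hx⟩

theorem leftEndpoint_succ_le_iff (h0 : ∀ k, 0 < c k) (h1 : ∀ k, c k < 1 / 2) (hm : Monotone c)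
    {K l : ℕ} {x : ℝ} (hx : x ∈ cantorSet c) (hl : l + 1 < 2 ^ K) :
    leftEndpoint c K (l + 1) ≤ x ↔ l < cantorIndex c K x := by
  obtain ⟨hi, hx⟩ := mem_Icc_cantorIndex h0 h1 hm K hx
  exact le_leftEndpoint_iff h0 h1 hm hi hl hx

theorem cantorHole_mem (h0 : ∀ k, 0 < c k) (h1 : ∀ k, c k < 1 / 2) (hm : Monotone c)
    {K l : ℕ} (hl : l + 1 < 2 ^ K) : cantorHole c K l ∈ holes (cantorSet c) := by
  refine Ioo_mem_holes (leftEndpoint_add_lt h0 h1 hm l.lt_succ_self hl)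
    (leftEndpoint_mem h0 h1 (by omega)).2 (leftEndpoint_mem h0 h1 hl).1 fun x hx => ?_
  obtain ⟨hi, hxi⟩ := mem_Icc_cantorIndex h0 h1 hm K hx
  rcases le_or_gt (l + 1) (cantorIndex c K x) with h | h
  · exact Or.inr ((leftEndpoint_succ_le_iff h0 h1 hm hx hl).2 h)
  · left
    rcases (Nat.lt_succ_iff.1 h).eq_or_lt with h | h
    · rw [← h]; exact hxi.2
    · have := stageLength_pos h0 K
      linarith [leftEndpoint_add_lt h0 h1 hm h (by omega : l < 2 ^ K), hxi.2]

theorem gapLength_le_diam_cantorHole (h0 : ∀ k, 0 < c k) (h1 : ∀ k, c k < 1 / 2)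
    (hm : Monotone c) {K l : ℕ} (hl : l + 1 < 2 ^ (K + 1)) :
    gapLength c K ≤ Metric.diam (cantorHole c (K + 1) l) := by
  rw [cantorHole, diam_Ioo_eq (leftEndpoint_add_lt h0 h1 hm l.lt_succ_self hl)]
  linarith [gapLength_le h0 h1 hm K l hl]

theorem cantorHole_injOn (h0 : ∀ k, 0 < c k) (h1 : ∀ k, c k < 1 / 2) (hm : Monotone c) (K : ℕ) :
    InjOn (cantorHole c K) {l | l + 1 < 2 ^ K} := by
  have hL := stageLength_pos h0 K
  have key : ∀ l l', l + 1 < 2 ^ K → l' + 1 < 2 ^ K → l < l' →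
      cantorHole c K l ≠ cantorHole c K l' := by
    intro l l' hl hl' hlt h
    obtain ⟨x, hx⟩ := nonempty_Ioo.2 (leftEndpoint_add_lt h0 h1 hm l.lt_succ_self hl)
    have hx' : x ∈ cantorHole c K l' := h ▸ hx
    have h2 := hx.2
    have h3 := hx'.1
    rcases (Nat.succ_le_iff.2 hlt).eq_or_lt with rfl | h4
    · simp only [Nat.succ_eq_add_one] at h3; linarith
    · have := leftEndpoint_add_lt h0 h1 hm h4 (by omega : l' < 2 ^ K)
      simp only [Nat.succ_eq_add_one] at this
      linarith
  intro l hl l' hl' h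
  rcases lt_trichotomy l l' with hlt | heq | hlt
  · exact absurd h (key l l' hl hl' hlt)
  · exact heq
  · exact absurd h.symm (key l' l hl' hl hlt)

theorem volume_cantorStage (h0 : ∀ k, 0 < c k) (h1 : ∀ k, c k < 1 / 2) (hm : Monotone c) (K : ℕ) :
    volume (cantorStage c K) = ENNReal.ofReal (∏ k ∈ Finset.range K, 2 * c k) := by
  rw [cantorStage_eq, measure_biUnion_finset]
  · simp only [Real.volume_Icc, add_sub_cancel_left, Finset.sum_const, Finset.card_range]
    rw [Finset.prod_mul_distrib, Finset.prod_const, Finset.card_range, ← stageLength,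
      ENNReal.ofReal_mul (by positivity), ENNReal.ofReal_pow (by norm_num), nsmul_eq_mul]
    norm_num
  · have key : ∀ i j, j < 2 ^ K → i < j →
        Disjoint (Icc (leftEndpoint c K i) (leftEndpoint c K i + stageLength c K))
          (Icc (leftEndpoint c K j) (leftEndpoint c K j + stageLength c K)) := by
      intro i j hj hij
      refine disjoint_left.2 fun x hx hx' => ?_
      linarith [leftEndpoint_add_lt h0 h1 hm hij hj, hx.2, hx'.1]
    intro i hi j hj hij
    rcases hij.lt_or_gt with h | h
    · exact key i j (by simpa using hj) h
    · exact (key j i (by simpa using hi) h).symm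
  · exact fun _ _ => measurableSet_Icc

theorem prod_ge_of_tendsto (h0 : ∀ k, 0 < c k) (h1 : ∀ k, c k < 1 / 2) {p : ℝ}
    (hp : Tendsto (fun n => ∏ k ∈ Finset.range n, 2 * c k) atTop (𝓝 p)) (K : ℕ) :
    p ≤ ∏ k ∈ Finset.range K, 2 * c k := by
  refine Antitone.le_of_tendsto (antitone_nat_of_succ_le fun n => ?_) hp K
  rw [Finset.prod_range_succ]
  have : 0 ≤ ∏ k ∈ Finset.range n, 2 * c k := Finset.prod_nonneg fun k _ => by linarith [h0 k]
  nlinarith [h1 n]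

theorem volume_cantorSet_pos (h0 : ∀ k, 0 < c k) (h1 : ∀ k, c k < 1 / 2) (hm : Monotone c)
    {p : ℝ} (hp0 : 0 < p)
    (hp : Tendsto (fun n => ∏ k ∈ Finset.range n, 2 * c k) atTop (𝓝 p)) :
    0 < volume (cantorSet c) := by
  have hanti := cantorStage_anti h0 h1
  have h := hanti.measure_iInter (μ := volume)
    (fun K => (isClosed_cantorStage c K).measurableSet.nullMeasurableSet)
    ⟨0, by rw [volume_cantorStage h0 h1 hm]; exact ENNReal.ofReal_ne_top⟩
  rw [cantorSet, h]
  refine (ENNReal.ofReal_pos.2 hp0).trans_le (le_iInf fun K => ?_)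
  rw [volume_cantorStage h0 h1 hm]
  exact ENNReal.ofReal_le_ofReal (prod_ge_of_tendsto h0 h1 hp K)

end CantorSet

/-! ### Characters of random sums -/

/-- The character `x ↦ exp (2πix)` of the line with values in `ℂ`. -/
noncomputable def phase (x : ℝ) : ℂ := (Real.fourierChar x : ℂ)

theorem phase_add (x y : ℝ) : phase (x + y) = phase x * phase y := by
  simp [phase, AddChar.map_add_eq_mul]

theorem norm_phase (x : ℝ) : ‖phase x‖ = 1 := Circle.norm_coe _

theorem continuous_phase : Continuous phase :=
  continuous_subtype_val.comp Real.continuous_fourierChar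

theorem phase_sum {ι : Type*} (s : Finset ι) (f : ι → ℝ) :
    phase (∑ i ∈ s, f i) = ∏ i ∈ s, phase (f i) := by
  classical
  induction s using Finset.induction_on with
  | empty => simp [phase]
  | insert i s hi ih => rw [Finset.sum_insert hi, Finset.prod_insert hi, phase_add, ih]

theorem conj_phase (x : ℝ) : (starRingEnd ℂ) (phase x) = phase (-x) :=
  Circle.starRingEnd_addChar x

theorem norm_phase_sub_le (x y : ℝ) : ‖phase x - phase y‖ ≤ 2 * Real.pi * |x - y| := by
  have h : phase x - phase y = phase y * (phase (x - y) - 1) := by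
    rw [mul_sub, ← phase_add, mul_one]; congr 2; ring
  rw [h, norm_mul, norm_phase, one_mul, phase, Real.fourierChar_apply]
  have := Real.norm_exp_I_mul_ofReal_sub_one_le (x := 2 * Real.pi * (x - y))
  rw [mul_comm]
  refine this.trans (le_of_eq ?_)
  rw [Real.norm_eq_abs, abs_mul, abs_of_pos (by positivity)]

theorem fourierTransform_eq (μ : Measure ℝ) (ξ : ℝ) :
    fourierTransform μ ξ = ∫ x, phase (-(ξ * x)) ∂μ := rfl

theorem norm_integral_phase_le {X : Type*} [MeasurableSpace X] (μ : Measure X)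
    [IsProbabilityMeasure μ] (f : X → ℝ) : ‖∫ x, phase (f x) ∂μ‖ ≤ 1 := by
  refine (norm_integral_le_of_norm_le_const (C := 1)
    (Eventually.of_forall fun x => (norm_phase _).le)).trans ?_
  simp

/-- The Fourier transform of the law of a convergent series of independent random variables is
bounded by the product of finitely many of the individual Fourier transforms. -/
theorem norm_integral_phase_tsum_le {ι : Type*} [Countable ι] {X : ι → Type*}
    [∀ i, MeasurableSpace (X i)] (μ : ∀ i, Measure (X i)) [∀ i, IsProbabilityMeasure (μ i)]
    {h : ∀ i, X i → ℝ} (hm : ∀ i, Measurable (h i))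
    (hsum : ∀ ω : ∀ i, X i, Summable fun i => h i (ω i)) (a : ℝ) (S : Finset ι) :
    ‖∫ ω, phase (a + ∑' i, h i (ω i)) ∂Measure.infinitePi μ‖ ≤
      ∏ i ∈ S, ‖∫ x, phase (h i x) ∂μ i‖ := by
  have hfin : ∀ T : Finset ι, ∫ ω, phase (a + ∑ i ∈ T, h i (ω i)) ∂Measure.infinitePi μ =
      phase a * ∏ i ∈ T, ∫ x, phase (h i x) ∂μ i := by
    intro T
    simp_rw [phase_add, integral_const_mul]
    congr 1
    have h1 : ∀ ω : ∀ i, X i, phase (∑ i ∈ T, h i (ω i)) =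
        (fun y : (∀ i : T, X i) => ∏ i : T, phase (h i (y i))) (T.restrict ω) := by
      intro ω
      rw [phase_sum, ← Finset.prod_coe_sort]
      rfl
    have h2 : Measurable fun y : (∀ i : T, X i) => ∏ i : T, phase (h i (y i)) :=
      Finset.measurable_fun_prod _ fun i _ =>
        continuous_phase.measurable.comp ((hm i).comp (measurable_pi_apply i))
    calc _ = ∫ ω : ∀ i, X i, (fun y : (∀ i : T, X i) => ∏ i : T, phase (h i (y i)))
          (T.restrict ω) ∂Measure.infinitePi μ := integral_congr_ae (ae_of_all _ h1)
      _ = ∏ i : T, ∫ x, phase (h i x) ∂μ i :=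
        (integral_restrict_infinitePi (μ := μ) h2.aestronglyMeasurable).trans
          (integral_fintype_prod_eq_prod fun (i : T) x => phase (h i x))
      _ = _ := Finset.prod_coe_sort T (fun i => ∫ x, phase (h i x) ∂μ i)
  have hlim : Tendsto (fun T : Finset ι => ∫ ω, phase (a + ∑ i ∈ T, h i (ω i))
      ∂Measure.infinitePi μ) atTop
      (𝓝 (∫ ω, phase (a + ∑' i, h i (ω i)) ∂Measure.infinitePi μ)) := by
    refine tendsto_integral_filter_of_dominated_convergence (fun _ => 1) ?_ ?_ ?_ ?_
    · refine Eventually.of_forall fun T => Measurable.aestronglyMeasurable ?_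
      refine continuous_phase.measurable.comp (measurable_const.add ?_)
      exact Finset.measurable_fun_sum _ fun i _ => (hm i).comp (measurable_pi_apply i)
    · exact Eventually.of_forall fun T => Eventually.of_forall fun ω => (norm_phase _).le
    · exact integrable_const _
    · refine Eventually.of_forall fun ω => ?_
      exact (continuous_phase.tendsto _).comp (tendsto_const_nhds.add (hsum ω).hasSum)
  refine le_of_tendsto hlim.norm ((eventually_ge_atTop S).mono fun T hT => ?_)
  rw [hfin, norm_mul, norm_phase, one_mul, norm_prod]
  classical
  rw [← Finset.prod_sdiff hT]
  exact mul_le_of_le_one_left (Finset.prod_nonneg fun _ _ => norm_nonneg _)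
    (Finset.prod_le_one (fun _ _ => norm_nonneg _) fun i _ => norm_integral_phase_le _ _)

/-! ### The random map on the closed set -/

section RandomMap

variable {E : Set ℝ} {m : ℕ} {α : ℝ} {φ : ℝ → ℝ}

theorem holeDelta_le (hm : 1 ≤ m) (hα : α ∈ Icc (0 : ℝ) 1) {U : Set ℝ}
    (hU : Metric.diam U ≤ 1) : holeDelta m α U ≤ 2 * Metric.diam U := by
  have h0 : 0 ≤ Metric.diam U := Metric.diam_nonneg
  have h1 : Metric.diam U ^ m ≤ Metric.diam U := by
    simpa using pow_le_pow_of_le_one h0 hU hm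
  have h2 : deltaFun α (Metric.diam U) ≤ 2 := by
    unfold deltaFun
    split_ifs with h
    · have hlog := Real.log_two_gt_d9
      have : Real.log 2 ≤ max (-Real.log (Metric.diam U)) (Real.log 2) := le_max_right _ _
      rw [div_le_iff₀ (by linarith)]
      linarith
    · exact (Real.rpow_le_one h0 hU hα.1).trans (by norm_num)
  rw [holeDelta, mul_comm]
  exact mul_le_mul h2 h1 (by positivity) (by norm_num)

/-- The indicator of the points to the right of `U`. -/
noncomputable def rightOf (U : Set ℝ) (x : ℝ) : ℝ := if sSup U ≤ x then 1 else 0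

theorem abs_rightOf_le (U : Set ℝ) (x : ℝ) : |rightOf U x| ≤ 1 := by
  unfold rightOf; split_ifs <;> simp

/-- The map `φ` interpolates across a hole, so for points outside the holes it only records which
holes lie to the left. -/
theorem randomMap_eq (hE : IsClosed E) (hφ_zero : ∀ x ≤ 0, φ x = 0) (hφ_one : ∀ x, 1 ≤ x → φ x = 1)
    {x : ℝ} (hx : x ∈ E) (ω : Omega E m α) :
    randomMap φ ω x = x + ∑' U : holes E, (ω U : ℝ) * rightOf U x := by
  unfold randomMap
  congr 2
  ext ⟨U, hU⟩
  obtain ⟨u, v, huv, rfl, hEuv⟩ := exists_eq_Ioo_of_mem_holes hE hU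
  congr 1
  simp only [rightOf, csInf_Ioo huv, csSup_Ioo huv, diam_Ioo_eq huv]
  rcases hEuv x hx with h | h
  · rw [if_neg (by linarith), hφ_zero]
    exact div_nonpos_of_nonpos_of_nonneg (by linarith) (by linarith)
  · rw [if_pos h, hφ_one]
    rw [le_div_iff₀ (by linarith)]; linarith

theorem measurable_randomMap (hE : IsClosed E) (hφ : Measurable φ) :
    Measurable fun p : Omega E m α × ℝ => randomMap φ p.1 p.2 := by
  have := (countable_holes hE).to_subtype
  unfold randomMap
  refine measurable_snd.add (Measurable.tsum fun U => ?_)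
  refine (measurable_subtype_coe.comp ((measurable_pi_apply U).comp measurable_fst)).mul ?_
  exact hφ.comp ((measurable_snd.sub_const _).div_const _)

theorem summable_holeDelta (hE : IsClosed E) (h0 : 0 ∈ E) (h1 : 1 ∈ E) (hE01 : E ⊆ Icc 0 1)
    (hm : 1 ≤ m) (hα : α ∈ Icc (0 : ℝ) 1) :
    Summable fun U : holes E => holeDelta m α (U : Set ℝ) := by
  refine Summable.of_nonneg_of_le (fun U => holeDelta_nonneg m α U) (fun U => holeDelta_le hm hα ?_)
    ((summable_diam_holes hE h0 h1 hE01).mul_left 2)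
  refine (Metric.diam_mono (hole_subset_Ioo hE h0 h1 hE01 U.2) (Metric.isBounded_Ioo _ _)).trans ?_
  rw [diam_Ioo_eq one_pos, sub_zero]

theorem summable_coord_mul (hδ : Summable fun U : holes E => holeDelta m α (U : Set ℝ))
    (ω : Omega E m α) {k : holes E → ℝ} {A : ℝ} (hk : ∀ U, |k U| ≤ A) :
    Summable fun U : holes E => (ω U : ℝ) * k U := by
  refine Summable.of_norm_bounded (hδ.mul_right A) fun U => ?_
  rw [Real.norm_eq_abs, abs_mul, abs_of_nonneg (ω U).2.1]
  exact mul_le_mul (ω U).2.2 (hk U) (abs_nonneg _) (holeDelta_nonneg m α U)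

theorem abs_randomMap_le (hE : IsClosed E) (hE01 : E ⊆ Icc 0 1)
    (hδ : Summable fun U : holes E => holeDelta m α (U : Set ℝ))
    (hφ_zero : ∀ x ≤ 0, φ x = 0) (hφ_one : ∀ x, 1 ≤ x → φ x = 1)
    {x : ℝ} (hx : x ∈ E) (ω : Omega E m α) :
    |randomMap φ ω x| ≤ 1 + ∑' U : holes E, holeDelta m α (U : Set ℝ) := by
  rw [randomMap_eq hE hφ_zero hφ_one hx]
  refine (abs_add_le _ _).trans (add_le_add ?_ ?_)
  · rw [abs_of_nonneg (hE01 hx).1]; exact (hE01 hx).2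
  · have hs := summable_coord_mul hδ ω (fun U => abs_rightOf_le (U : Set ℝ) x)
    refine abs_le.2 ⟨?_, hs.tsum_le_tsum (fun U => ?_) hδ⟩
    · refine le_trans (neg_nonpos.2 (tsum_nonneg fun U => holeDelta_nonneg m α U))
        (tsum_nonneg fun U => mul_nonneg (ω U).2.1 ?_)
      unfold rightOf; split_ifs <;> simp
    · exact (mul_le_of_le_one_right (ω U).2.1 (le_of_abs_le (abs_rightOf_le _ _))).trans (ω U).2.2

/-- For fixed points `z i` of `E`, the random phase of the combination `∑ ε i * f_ω (z i)` is a
series of independent terms; the hole `U` contributes with the coefficient `∑ ε i` taken over the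
points to the right of `U`. -/
theorem norm_integral_phase_randomMap_le (hE : IsClosed E)
    (hδ : Summable fun U : holes E => holeDelta m α (U : Set ℝ))
    (hφ_zero : ∀ x ≤ 0, φ x = 0) (hφ_one : ∀ x, 1 ≤ x → φ x = 1)
    (ν : Measure (Icc (0 : ℝ) 1)) [IsProbabilityMeasure ν] {ι : Type*} [Fintype ι]
    (ε : ι → ℝ) {z : ι → ℝ} (hz : ∀ i, z i ∈ E) (ξ : ℝ) (S : Finset (holes E)) :
    ‖∫ ω, phase (∑ i, -(ε i * ξ * randomMap φ ω (z i))) ∂productMeasure E m α ν‖ ≤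
      ∏ U ∈ S, ‖fourierTransform (ν.map Subtype.val)
        (ξ * (∑ i, ε i * rightOf (U : Set ℝ) (z i)) * holeDelta m α (U : Set ℝ))‖ := by
  have := (countable_holes hE).to_subtype
  have hprob : ∀ U : holes E, IsProbabilityMeasure (ν.map (scale m α U)) := fun U =>
    Measure.isProbabilityMeasure_map (measurable_scale m α U).aemeasurable
  let k : holes E → ℝ := fun U => -(ξ * ∑ i, ε i * rightOf (U : Set ℝ) (z i))
  have hk : ∀ U, |k U| ≤ |ξ| * ∑ i, |ε i| := by
    intro U
    rw [abs_neg, abs_mul]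
    gcongr
    refine (Finset.abs_sum_le_sum_abs _ _).trans (Finset.sum_le_sum fun i _ => ?_)
    rw [abs_mul]
    exact mul_le_of_le_one_right (abs_nonneg _) (abs_rightOf_le _ _)
  have hsum : ∀ ω : Omega E m α, Summable fun U : holes E => (ω U : ℝ) * k U := fun ω =>
    summable_coord_mul hδ ω hk
  have heq : ∀ ω : Omega E m α, ∑ i, -(ε i * ξ * randomMap φ ω (z i)) =
      (∑ i, -(ε i * ξ * z i)) + ∑' U : holes E, (ω U : ℝ) * k U := by
    intro ω
    have h1 : ∀ i, -(ε i * ξ * randomMap φ ω (z i)) = -(ε i * ξ * z i) +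
        ∑' U : holes E, -(ε i * ξ) * ((ω U : ℝ) * rightOf U (z i)) := by
      intro i
      rw [randomMap_eq hE hφ_zero hφ_one (hz i), tsum_mul_left]; ring
    simp_rw [h1]
    rw [Finset.sum_add_distrib, ← Summable.tsum_finsetSum]
    · congr 2
      ext U
      simp only [k, ← Finset.sum_neg_distrib, Finset.mul_sum]
      exact Finset.sum_congr rfl fun i _ => by ring
    · intro i _
      exact (summable_coord_mul hδ ω (fun U => abs_rightOf_le (U : Set ℝ) (z i))).mul_left _
  simp_rw [heq]
  refine (norm_integral_phase_tsum_le (fun U : holes E => ν.map (scale m α U))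
    (h := fun U x => (x : ℝ) * k U) (fun U => measurable_subtype_coe.mul_const _)
    hsum _ S).trans (le_of_eq (Finset.prod_congr rfl fun U _ => ?_))
  rw [fourierTransform_eq, integral_map (measurable_scale m α U).aemeasurable,
    integral_map measurable_subtype_coe.aemeasurable]
  · congr 2
    ext x
    simp only [scale, k]
    congr 1; ring
  · exact (continuous_phase.measurable.comp (by fun_prop)).aestronglyMeasurable
  · exact (continuous_phase.measurable.comp
      (measurable_subtype_coe.mul_const _)).aestronglyMeasurable

end RandomMap

/-! ### Combinatorics of finitely many points -/

/-- Sort `2 q` integers and pair each of them in an odd place with its successor. A level `l`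
between the two members of a pair has an odd number of the integers above it. Thus either there
are many levels with that property, or all the pairs consist of neighbouring integers. -/
theorem exists_perm_or_card_le {q M N : ℕ} (J : Fin q × Fin 2 → ℕ) (hJ : ∀ i, J i ≤ M) :
    N ≤ (Finset.univ.filter fun l : Fin M =>
        Odd (Finset.univ.filter fun i => (l : ℕ) < J i).card).card ∨
      ∃ σ : Equiv.Perm (Fin q × Fin 2), ∀ i,
        J (σ (i, 0)) ≤ J (σ (i, 1)) ∧ J (σ (i, 1)) < J (σ (i, 0)) + N := by
  classical
  let e : Fin q × Fin 2 ≃ Fin (q * 2) := finProdFinEquiv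
  let τ : Equiv.Perm (Fin (q * 2)) := Tuple.sort (J ∘ e.symm)
  have hτ : Monotone (fun j => J (e.symm (τ j))) := Tuple.monotone_sort (J ∘ e.symm)
  let σ : Equiv.Perm (Fin q × Fin 2) := (e.trans τ).trans e.symm
  have he : ∀ (i : Fin q) (b : Fin 2), ((e (i, b) : Fin (q * 2)) : ℕ) = b + 2 * i := fun i b => rfl
  have hle : ∀ i, J (σ (i, 0)) ≤ J (σ (i, 1)) := fun i => hτ (by
    rw [Fin.le_def, he, he]; simp)
  by_cases hN : ∀ i, J (σ (i, 1)) < J (σ (i, 0)) + N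
  · exact Or.inr ⟨σ, fun i => ⟨hle i, hN i⟩⟩
  left
  push Not at hN
  obtain ⟨i, hi⟩ := hN
  have hodd : ∀ l, J (σ (i, 0)) ≤ l → l < J (σ (i, 1)) →
      Odd (Finset.univ.filter fun i => l < J i).card := by
    intro l h1 h2
    have hcard : (Finset.univ.filter fun i => l < J i).card =
        (Finset.Ici (e (i, 1))).card := by
      refine Finset.card_bij' (fun x _ => τ.symm (e x)) (fun x _ => e.symm (τ x)) ?_ ?_ ?_ ?_
      · intro x hx
        rw [Finset.mem_filter] at hx
        rw [Finset.mem_Ici]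
        by_contra hcon
        have hle' : τ.symm (e x) ≤ e (i, 0) := by
          rw [not_le, Fin.lt_def, he] at hcon
          rw [Fin.le_def, he]
          simp at hcon ⊢; omega
        have := hτ hle'
        simp only [Equiv.apply_symm_apply, Equiv.symm_apply_apply] at this
        exact absurd (hx.2.trans_le (this.trans h1)) (lt_irrefl _)
      · intro x hx
        rw [Finset.mem_Ici] at hx
        exact Finset.mem_filter.2 ⟨Finset.mem_univ _, h2.trans_le (hτ hx)⟩
      · intro x _; simp
      · intro x _; simp
    rw [hcard, Fin.card_Ici, he]
    have := i.2
    exact ⟨q - i - 1, by simp; omega⟩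
  have hN' : N ≤ (Finset.Ico (J (σ (i, 0))) (J (σ (i, 1)))).card := by
    rw [Nat.card_Ico]; omega
  refine hN'.trans (Finset.card_le_card_of_surjOn (fun l : Fin M => (l : ℕ)) fun l hl => ?_)
  rw [Finset.coe_Ico] at hl
  have hlM : l < M := hl.2.trans_le (hJ _)
  exact ⟨⟨l, hlM⟩, by simpa using hodd l hl.1 hl.2, rfl⟩

/-- The sign attached to a point: `1` for a factor of the Fourier transform and `-1` for a factor
of its conjugate. -/
def pairSign {q : ℕ} (i : Fin q × Fin 2) : ℤ := if i.2 = 0 then 1 else -1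

theorem sum_pairSign_ne_zero {q : ℕ} (s : Finset (Fin q × Fin 2)) (hs : Odd s.card) :
    ∑ i ∈ s, pairSign i ≠ 0 := by
  intro h0
  have h1 : ((∑ i ∈ s, pairSign i : ℤ) : ZMod 2) = s.card := by
    push_cast
    rw [Finset.sum_congr rfl (g := fun _ => (1 : ZMod 2))]
    · simp
    · intro i _
      unfold pairSign
      split_ifs <;> simp
  rw [h0, Int.cast_zero, eq_comm, ZMod.natCast_eq_zero_iff_even] at h1
  exact Nat.not_even_iff_odd.2 hs h1

/-! ### Close pairs under a product measure -/

theorem pi_close_pairs_le {q N : ℕ} (μ : Measure ℝ) [IsProbabilityMeasure μ] {J : ℝ → ℕ}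
    (hJ : Measurable J) {b : ℝ≥0∞} (hb : ∀ j, μ (J ⁻¹' {j}) ≤ b)
    (σ : Equiv.Perm (Fin q × Fin 2)) :
    Measure.pi (fun _ : Fin q × Fin 2 => μ) {z | ∀ i, J (z (σ (i, 0))) ≤ J (z (σ (i, 1))) ∧
      J (z (σ (i, 1))) < J (z (σ (i, 0))) + N} ≤ (N * b) ^ q := by
  have hperm : (Measure.pi fun _ : Fin q × Fin 2 => μ).map (fun z i => z (σ i)) =
      Measure.pi fun _ => μ := by
    refine (Measure.pi_eq fun s hs => ?_).symm
    rw [Measure.map_apply (by fun_prop) (MeasurableSet.univ_pi hs)]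
    have : (fun (z : Fin q × Fin 2 → ℝ) i => z (σ i)) ⁻¹' univ.pi s =
        univ.pi fun i => s (σ.symm i) := by
      ext z
      simp only [mem_preimage, mem_univ_pi]
      exact ⟨fun h i => by simpa using h (σ.symm i), fun h i => by simpa using h (σ i)⟩
    rw [this, Measure.pi_pi]
    exact Equiv.prod_comp σ.symm fun i => μ (s i)
  let D : Set (ℝ × ℝ) := {p | J p.1 ≤ J p.2 ∧ J p.2 < J p.1 + N}
  have hJ1 : Measurable fun p : ℝ × ℝ => J p.1 := hJ.comp measurable_fst
  have hJ2 : Measurable fun p : ℝ × ℝ => J p.2 := hJ.comp measurable_snd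
  have hD : MeasurableSet D :=
    (measurableSet_le hJ1 hJ2).inter (measurableSet_lt hJ2 (hJ1.add_const N))
  have hDμ : (μ.prod μ) D ≤ N * b := by
    rw [Measure.prod_apply hD]
    calc _ ≤ ∫⁻ _, N * b ∂μ := by
          refine lintegral_mono fun x => ?_
          calc μ (Prod.mk x ⁻¹' D) ≤ μ (⋃ k ∈ Finset.range N, J ⁻¹' {J x + k}) := by
                refine measure_mono fun y hy => ?_
                obtain ⟨h1, h2⟩ : J x ≤ J y ∧ J y < J x + N := hy
                simp only [mem_iUnion, mem_preimage, mem_singleton_iff, Finset.mem_range]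
                exact ⟨J y - J x, by omega, by omega⟩
            _ ≤ ∑ k ∈ Finset.range N, μ (J ⁻¹' {J x + k}) := measure_biUnion_finset_le _ _
            _ ≤ ∑ k ∈ Finset.range N, b := Finset.sum_le_sum fun _ _ => hb _
            _ = N * b := by simp
      _ = N * b := by simp
  have hcurry := Measure.infinitePi_map_curry (fun (_ : Fin q) (_ : Fin 2) => μ)
  simp_rw [Measure.infinitePi_eq_pi] at hcurry
  let D' : Set (Fin 2 → ℝ) := MeasurableEquiv.finTwoArrow ⁻¹' D
  have hD' : MeasurableSet D' := MeasurableEquiv.finTwoArrow.measurable hD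
  have hset : {z : Fin q × Fin 2 → ℝ | ∀ i, J (z (σ (i, 0))) ≤ J (z (σ (i, 1))) ∧
      J (z (σ (i, 1))) < J (z (σ (i, 0))) + N} = (fun z i => z (σ i)) ⁻¹'
        (MeasurableEquiv.curry (Fin q) (Fin 2) ℝ ⁻¹' univ.pi fun _ => D') := by
    ext z
    simp only [mem_ofPred_eq, mem_preimage, mem_univ_pi, D', D]
    rfl
  have hmeas : MeasurableSet (univ.pi fun _ : Fin q => D') := MeasurableSet.univ_pi fun _ => hD'
  rw [hset, ← Measure.map_apply (by fun_prop)
    ((MeasurableEquiv.curry (Fin q) (Fin 2) ℝ).measurable hmeas), hperm,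
    ← Measure.map_apply (MeasurableEquiv.measurable _) hmeas, hcurry, Measure.pi_pi]
  simp only [D', (measurePreserving_finTwoArrow μ).measure_preimage hD.nullMeasurableSet]
  rw [Finset.prod_const, Finset.card_univ, Fintype.card_fin]
  exact pow_le_pow_left' hDμ q

/-! ### Moments of the Fourier transform of the random measure -/

section Moments

variable {E : Set ℝ} {m : ℕ} {α : ℝ} {φ : ℝ → ℝ}

theorem measurable_randomMap_left (hE : IsClosed E) (hφ : Measurable φ) (ω : Omega E m α) :
    Measurable (randomMap φ ω) :=
  (measurable_randomMap hE hφ).comp measurable_prodMk_left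

theorem fourierTransform_map_randomMap (hE : IsClosed E) (hφ : Measurable φ) (μ : Measure ℝ)
    (ω : Omega E m α) (ξ : ℝ) : fourierTransform (μ.map (randomMap φ ω)) ξ =
      ∫ x, phase (-(ξ * randomMap φ ω x)) ∂μ := by
  rw [fourierTransform_eq, integral_map (measurable_randomMap_left hE hφ ω).aemeasurable]
  exact (continuous_phase.comp (by fun_prop)).aestronglyMeasurable

theorem measurable_fourierTransform_map (hE : IsClosed E) (hφ : Measurable φ) (μ : Measure ℝ)
    [IsProbabilityMeasure μ] (ξ : ℝ) :
    Measurable fun ω : Omega E m α => fourierTransform (μ.map (randomMap φ ω)) ξ := by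
  simp_rw [fourierTransform_map_randomMap hE hφ]
  refine StronglyMeasurable.measurable (StronglyMeasurable.integral_prod_right
    (f := fun (ω : Omega E m α) x => phase (-(ξ * randomMap φ ω x))) ?_)
  exact (continuous_phase.measurable.comp
    ((measurable_randomMap hE hφ).const_mul ξ).neg).stronglyMeasurable

/-- An even power of the modulus of a Fourier transform is a multiple integral. -/
theorem norm_fourierTransform_pow_eq (hE : IsClosed E) (hφ : Measurable φ) (μ : Measure ℝ)
    [IsProbabilityMeasure μ] (q : ℕ) (ω : Omega E m α) (ξ : ℝ) :
    ((‖fourierTransform (μ.map (randomMap φ ω)) ξ‖ ^ (2 * q) : ℝ) : ℂ) =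
      ∫ z : Fin q × Fin 2 → ℝ, phase (∑ i, -(((pairSign i : ℤ) : ℝ) * ξ * randomMap φ ω (z i)))
        ∂Measure.pi fun _ => μ := by
  simp_rw [phase_sum]
  rw [integral_fintype_prod_eq_prod
    (fun (i : Fin q × Fin 2) x => phase (-(((pairSign i : ℤ) : ℝ) * ξ * randomMap φ ω x))),
    Fintype.prod_prod_type]
  have hpair : ∀ i : Fin q, ∏ j : Fin 2, ∫ x, phase (-(((pairSign (i, j) : ℤ) : ℝ) * ξ *
      randomMap φ ω x)) ∂μ = ((‖fourierTransform (μ.map (randomMap φ ω)) ξ‖ ^ 2 : ℝ) : ℂ) := by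
    intro i
    rw [Complex.ofReal_pow, ← Complex.mul_conj', fourierTransform_map_randomMap hE hφ,
      ← integral_conj, Fin.prod_univ_two]
    simp [pairSign, conj_phase]
  rw [Finset.prod_congr rfl fun i _ => hpair i, Finset.prod_const, Finset.card_univ,
    Fintype.card_fin, pow_mul, Complex.ofReal_pow]

/-- The moment bound. Points of `E` are sorted into `M + 1` cells by `J`, and consecutive cells
are separated by a hole that is so long that its random coordinate contributes a factor of at most
`1 / 2` whenever it occurs with a nonzero coefficient. Either the `2 q` points of the multiple
integral are spread out, in which case at least `N` such factors occur, or they come in `q` close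
pairs, which is improbable. -/
theorem integral_norm_fourierTransform_pow_le (hE : IsClosed E)
    (hδ : Summable fun U : holes E => holeDelta m α (U : Set ℝ)) (hφ : Measurable φ)
    (hφ_zero : ∀ x ≤ 0, φ x = 0) (hφ_one : ∀ x, 1 ≤ x → φ x = 1)
    (ν : Measure (Icc (0 : ℝ) 1)) [IsProbabilityMeasure ν]
    (μ : Measure ℝ) [IsProbabilityMeasure μ] (hμE : μ Eᶜ = 0) {ξ : ℝ} {M : ℕ} {J : ℝ → ℕ}
    (hJ : Measurable J) (hJM : ∀ x ∈ E, J x ≤ M) {b : ℝ} (hb0 : 0 ≤ b)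
    (hb : ∀ j, μ (J ⁻¹' {j}) ≤ ENNReal.ofReal b)
    {hole : Fin M → holes E} (hinj : Function.Injective hole)
    (hright : ∀ l, ∀ x ∈ E, sSup (hole l : Set ℝ) ≤ x ↔ (l : ℕ) < J x)
    (hdecay : ∀ l, ∀ k : ℤ, k ≠ 0 → ‖fourierTransform (ν.map Subtype.val)
      (ξ * k * holeDelta m α (hole l : Set ℝ))‖ ≤ 1 / 2) (q N : ℕ) :
    ∫ ω, ‖fourierTransform (μ.map (randomMap φ ω)) ξ‖ ^ (2 * q) ∂productMeasure E m α ν ≤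
      (2 * q).factorial * (N * b) ^ q + (1 / 2) ^ N := by
  classical
  set Q : Measure (Fin q × Fin 2 → ℝ) := Measure.pi fun _ => μ
  set P := productMeasure E m α ν
  let B : Set (Fin q × Fin 2 → ℝ) := ⋃ σ : Equiv.Perm (Fin q × Fin 2),
    {z | ∀ i, J (z (σ (i, 0))) ≤ J (z (σ (i, 1))) ∧ J (z (σ (i, 1))) < J (z (σ (i, 0))) + N}
  have hB : Q.real (toMeasurable Q B) ≤ (2 * q).factorial * (N * b) ^ q := by
    rw [measureReal_def, measure_toMeasurable]
    refine ENNReal.toReal_le_of_le_ofReal (by positivity) ?_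
    calc Q B ≤ ∑ σ : Equiv.Perm (Fin q × Fin 2), (N * ENNReal.ofReal b) ^ q :=
          (measure_iUnion_fintype_le _ _).trans
            (Finset.sum_le_sum fun σ _ => pi_close_pairs_le μ hJ hb σ)
      _ = ENNReal.ofReal ((2 * q).factorial * (N * b) ^ q) := by
          rw [ENNReal.ofReal_mul (by positivity), ENNReal.ofReal_pow (by positivity),
            ENNReal.ofReal_mul (by positivity)]
          simp [Fintype.card_perm, mul_comm q 2]
  let g : Omega E m α → (Fin q × Fin 2 → ℝ) → ℂ := fun ω z =>
    phase (∑ i, -(((pairSign i : ℤ) : ℝ) * ξ * randomMap φ ω (z i)))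
  have hg : Measurable (Function.uncurry g) := by
    refine continuous_phase.measurable.comp (Finset.measurable_fun_sum _ fun i _ => ?_)
    have h1 : Measurable fun p : Omega E m α × (Fin q × Fin 2 → ℝ) => (p.1, p.2 i) :=
      measurable_fst.prodMk ((measurable_pi_apply i).comp measurable_snd)
    have h2 := ((measurable_randomMap (m := m) (α := α) hE hφ).comp h1).const_mul
      (((pairSign i : ℤ) : ℝ) * ξ)
    exact h2.neg
  have hint : Integrable (Function.uncurry g) (P.prod Q) :=
    Integrable.of_bound hg.aestronglyMeasurable 1 (ae_of_all _ fun p => (norm_phase _).le)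
  have hpt : ∀ z : Fin q × Fin 2 → ℝ, (∀ i, z i ∈ E) →
      ‖∫ ω, g ω z ∂P‖ ≤ (toMeasurable Q B).indicator 1 z + (1 / 2) ^ N := by
    intro z hz
    by_cases hzB : z ∈ toMeasurable Q B
    · rw [indicator_of_mem hzB]
      refine (norm_integral_phase_le _ _).trans ?_
      simp
    rw [indicator_of_notMem hzB, zero_add]
    rcases exists_perm_or_card_le (N := N) (fun i => J (z i)) (fun i => hJM _ (hz i)) with h | h
    · set T := Finset.univ.filter fun l : Fin M =>
        Odd (Finset.univ.filter fun i => (l : ℕ) < J (z i)).card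
      refine (norm_integral_phase_randomMap_le hE hδ hφ_zero hφ_one ν
        (fun i => ((pairSign i : ℤ) : ℝ)) hz ξ (T.map ⟨hole, hinj⟩)).trans ?_
      rw [Finset.prod_map]
      calc _ ≤ ∏ l ∈ T, (1 / 2 : ℝ) := by
            refine Finset.prod_le_prod (fun _ _ => norm_nonneg _) fun l hl => ?_
            have hsum : ∑ i, ((pairSign i : ℤ) : ℝ) * rightOf (hole l : Set ℝ) (z i) =
                ((∑ i ∈ Finset.univ.filter (fun i => (l : ℕ) < J (z i)), pairSign i : ℤ) : ℝ) := by
              push_cast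
              rw [Finset.sum_filter]
              refine Finset.sum_congr rfl fun i _ => ?_
              simp only [rightOf, hright l _ (hz i), mul_ite, mul_one, mul_zero]
            rw [Function.Embedding.coeFn_mk, hsum]
            exact hdecay l _ (sum_pairSign_ne_zero _ (Finset.mem_filter.1 hl).2)
        _ = (1 / 2) ^ T.card := by rw [Finset.prod_const]
        _ ≤ (1 / 2) ^ N := pow_le_pow_of_le_one (by norm_num) (by norm_num) h
    · exact absurd (subset_toMeasurable Q B (mem_iUnion.2 h)) hzB
  have hzE : ∀ᵐ z ∂Q, ∀ i, z i ∈ E := by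
    refine eventually_all.2 fun i => ?_
    have : ∀ᵐ x ∂μ, x ∈ E := hμE
    exact (Measure.tendsto_eval_ae_ae (μ := fun _ : Fin q × Fin 2 => μ) (i := i)).eventually this
  have hnonneg : 0 ≤ ∫ ω, ‖fourierTransform (μ.map (randomMap φ ω)) ξ‖ ^ (2 * q) ∂P :=
    integral_nonneg fun ω => by positivity
  have heq : ((∫ ω, ‖fourierTransform (μ.map (randomMap φ ω)) ξ‖ ^ (2 * q) ∂P : ℝ) : ℂ) =
      ∫ z, ∫ ω, g ω z ∂P ∂Q := by
    rw [← integral_complex_ofReal, ← integral_integral_swap hint]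
    exact integral_congr_ae (ae_of_all _ fun ω => norm_fourierTransform_pow_eq hE hφ μ q ω ξ)
  calc _ = ‖∫ z, ∫ ω, g ω z ∂P ∂Q‖ := by
        rw [← heq, Complex.norm_real, Real.norm_of_nonneg hnonneg]
    _ ≤ ∫ z, ‖∫ ω, g ω z ∂P‖ ∂Q := norm_integral_le_integral_norm _
    _ ≤ ∫ z, ((toMeasurable Q B).indicator 1 z + (1 / 2) ^ N) ∂Q := by
        refine integral_mono_ae hint.integral_prod_right.norm ?_ (hzE.mono hpt)
        exact ((integrable_const 1).indicator (measurableSet_toMeasurable _ _)).add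
          (integrable_const _)
    _ = Q.real (toMeasurable Q B) + (1 / 2) ^ N := by
        rw [integral_add ((integrable_const 1).indicator (measurableSet_toMeasurable _ _))
          (integrable_const _), integral_indicator_one (measurableSet_toMeasurable _ _)]
        simp
    _ ≤ _ := by gcongr

end Moments

/-! ### Lower bounds for the lengths of the holes -/

theorem exists_pos_le_of_eventually {u : ℕ → ℝ} (hu : ∀ n, 0 < u n) {a : ℝ} (ha : 0 < a)
    (h : ∀ᶠ n in atTop, a ≤ u n) : ∃ b > 0, ∀ n, b ≤ u n := by
  obtain ⟨N, hN⟩ := eventually_atTop.1 h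
  obtain ⟨k, -, hk⟩ := Finset.exists_min_image (Finset.range (N + 1)) u ⟨0, by simp⟩
  refine ⟨min a (u k), lt_min ha (hu k), fun n => ?_⟩
  rcases le_or_gt N n with hn | hn
  · exact (min_le_left _ _).trans (hN n hn)
  · exact (min_le_right _ _).trans (hk n (Finset.mem_range.2 (by omega)))

theorem exists_le_gapLength {c : ℕ → ℝ} (h0 : ∀ k, 0 < c k) (h1 : ∀ k, c k < 1 / 2)
    {p : ℝ} (hp0 : 0 < p) (hp : Tendsto (fun n => ∏ k ∈ Finset.range n, 2 * c k) atTop (𝓝 p))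
    (hc_log : Tendsto (fun k : ℕ => Real.log (1 - 2 * c k) / ((k : ℝ) + 1)) atTop (𝓝 0))
    {ε : ℝ} (hε : 0 < ε) :
    ∃ b > 0, ∀ K : ℕ, b * (2 : ℝ) ^ (-((1 + ε) * K)) ≤ gapLength c K := by
  have hlog2 : 0 < Real.log 2 := Real.log_pos (by norm_num)
  have hpos : ∀ K, 0 < 1 - 2 * c K := fun K => by linarith [h1 K]
  have hev : ∀ᶠ K : ℕ in atTop,
      (2 : ℝ) ^ (-ε) ≤ (1 - 2 * c K) * (2 : ℝ) ^ (ε * K) := by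
    have := hc_log.eventually (lt_mem_nhds (show -(ε * Real.log 2) < 0 by
      rw [neg_lt_zero]; positivity))
    refine this.mono fun K hK => ?_
    rw [lt_div_iff₀ (by positivity)] at hK
    rw [← Real.log_le_log_iff (by positivity) (mul_pos (hpos K) (by positivity)),
      Real.log_mul (hpos K).ne' (by positivity), Real.log_rpow (by norm_num),
      Real.log_rpow (by norm_num)]
    nlinarith
  obtain ⟨b, hb, hbK⟩ := exists_pos_le_of_eventually
    (u := fun K : ℕ => (1 - 2 * c K) * (2 : ℝ) ^ (ε * K))
    (fun K => mul_pos (hpos K) (by positivity)) (by positivity) hev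
  refine ⟨b * p, mul_pos hb hp0, fun K => ?_⟩
  have hlen : p * (2 : ℝ) ^ (-(K : ℝ)) ≤ stageLength c K := by
    have := prod_ge_of_tendsto h0 h1 hp K
    rw [Finset.prod_mul_distrib, Finset.prod_const, Finset.card_range, ← stageLength] at this
    rw [Real.rpow_neg (by norm_num), Real.rpow_natCast, ← div_eq_mul_inv,
      div_le_iff₀ (by positivity)]
    linarith
  have hfac : b * (2 : ℝ) ^ (-(ε * K)) ≤ 1 - 2 * c K := by
    rw [Real.rpow_neg (by norm_num), ← div_eq_mul_inv, div_le_iff₀ (by positivity)]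
    exact hbK K
  calc _ = (b * (2 : ℝ) ^ (-(ε * K))) * (p * (2 : ℝ) ^ (-(K : ℝ))) := by
        have : (2 : ℝ) ^ (-((1 + ε) * K)) = (2 : ℝ) ^ (-(ε * K)) * (2 : ℝ) ^ (-(K : ℝ)) := by
          rw [← Real.rpow_add (by norm_num)]; congr 1; ring
        rw [this]; ring
    _ ≤ (1 - 2 * c K) * stageLength c K := mul_le_mul hfac hlen (by positivity) (hpos K).le
    _ = _ := (gapLength_eq c K).symm

/-- Up to an arbitrarily small loss in the exponent, `δ(t)` behaves like `t ^ α`, also when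
`α = 0`. -/
theorem exists_le_deltaFun {α : ℝ} {ε : ℝ} (hε : 0 < ε) :
    ∃ b > 0, ∀ t, 0 < t → t ≤ 1 → b * t ^ (α + ε) ≤ deltaFun α t := by
  by_cases hα : α = 0
  · refine ⟨min ε 1, lt_min hε one_pos, fun t ht ht1 => ?_⟩
    rw [deltaFun, if_pos hα, hα, zero_add]
    have hlog2 : 0 < Real.log 2 := Real.log_pos (by norm_num)
    have hb : 0 < min ε 1 := lt_min hε one_pos
    have hte : 0 < t ^ ε := Real.rpow_pos_of_pos ht ε
    have hte1 : t ^ ε ≤ 1 := Real.rpow_le_one ht.le ht1 hε.le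
    rw [le_div_iff₀ (lt_max_of_lt_right hlog2), mul_max_of_nonneg _ _ (by positivity)]
    refine max_le ?_ ?_
    · have h1 : -Real.log t ≤ (t ^ ε)⁻¹ / ε := by
        rw [← Real.log_inv, ← Real.inv_rpow ht.le]
        exact Real.log_le_rpow_div (by positivity) hε
      calc min ε 1 * t ^ ε * -Real.log t ≤ ε * t ^ ε * ((t ^ ε)⁻¹ / ε) := by
            refine mul_le_mul ?_ h1 ?_ (by positivity)
            · gcongr; exact min_le_left _ _
            · rw [neg_nonneg]; exact Real.log_nonpos ht.le ht1
        _ = 1 := by field_simp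
    · have : Real.log 2 ≤ 1 := by linarith [Real.log_two_lt_d9]
      calc min ε 1 * t ^ ε * Real.log 2 ≤ 1 * 1 * 1 := by
            gcongr; exact min_le_right _ _
        _ = 1 := by norm_num
  · refine ⟨1, one_pos, fun t ht ht1 => ?_⟩
    rw [deltaFun, if_neg hα, one_mul]
    exact Real.rpow_le_rpow_of_exponent_ge ht ht1 (by linarith)

theorem exists_le_holeDelta_cantorHole {c : ℕ → ℝ} (h0 : ∀ k, 0 < c k) (h1 : ∀ k, c k < 1 / 2)
    (hm : Monotone c) {p : ℝ} (hp0 : 0 < p)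
    (hp : Tendsto (fun n => ∏ k ∈ Finset.range n, 2 * c k) atTop (𝓝 p))
    (hc_log : Tendsto (fun k : ℕ => Real.log (1 - 2 * c k) / ((k : ℝ) + 1)) atTop (𝓝 0))
    {m : ℕ} {α β : ℝ} (hα : 0 ≤ α) (hβ : m + α < β) :
    ∃ b > 0, ∀ K l : ℕ, l + 1 < 2 ^ K →
      b * (2 : ℝ) ^ (-(β * K)) ≤ holeDelta m α (cantorHole c K l) := by
  have hmα : 0 ≤ m + α := by positivity
  -- With `ε ≤ 1` this choice gives `(1 + ε) * (m + α + ε) ≤ β`.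
  set ε : ℝ := min 1 ((β - (m + α)) / (m + α + 2)) with hεdef
  have hε : 0 < ε := lt_min one_pos (div_pos (by linarith) (by linarith))
  have hε1 : ε ≤ 1 := min_le_left _ _
  have hε2 : ε * (m + α + 2) ≤ β - (m + α) := by
    rw [← le_div_iff₀ (by linarith)]; exact min_le_right _ _
  have hβε : (1 + ε) * (m + α + ε) ≤ β := by nlinarith
  obtain ⟨b₁, hb₁, hgap⟩ := exists_le_gapLength h0 h1 hp0 hp hc_log hε
  obtain ⟨b₂, hb₂, hδ⟩ := exists_le_deltaFun (α := α) hε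
  refine ⟨b₂ * b₁ ^ (m + α + ε), by positivity, fun K l hl => ?_⟩
  cases K with
  | zero => simp at hl
  | succ K =>
    set t := Metric.diam (cantorHole c (K + 1) l) with ht
    have hgt : gapLength c K ≤ t := gapLength_le_diam_cantorHole h0 h1 hm hl
    have ht0 : 0 < t := (gapLength_pos h0 h1 K).trans_le hgt
    have ht1 : t ≤ 1 := by
      refine (Metric.diam_mono (hole_subset_Ioo (isClosed_cantorSet c) (zero_mem_cantorSet h0 h1)
        (one_mem_cantorSet h0 h1) (cantorSet_subset_Icc c) (cantorHole_mem h0 h1 hm hl))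
        (Metric.isBounded_Ioo _ _)).trans ?_
      rw [diam_Ioo_eq one_pos, sub_zero]
    calc _ = b₂ * (b₁ ^ (m + α + ε) * (2 : ℝ) ^ (-(β * (K + 1 : ℕ)))) := by ring
      _ ≤ b₂ * (b₁ ^ (m + α + ε) * (2 : ℝ) ^ (-((1 + ε) * K) * (m + α + ε))) := by
          gcongr
          · norm_num
          · push_cast
            have : (0 : ℝ) ≤ K := Nat.cast_nonneg K
            nlinarith
      _ = b₂ * (b₁ * (2 : ℝ) ^ (-((1 + ε) * K))) ^ (m + α + ε) := by
          rw [Real.mul_rpow hb₁.le (by positivity), ← Real.rpow_mul (by norm_num)]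
      _ ≤ b₂ * t ^ (m + α + ε) := by
          gcongr
          exact (hgap K).trans hgt
      _ = t ^ m * (b₂ * t ^ (α + ε)) := by
          rw [add_assoc, Real.rpow_add ht0, Real.rpow_natCast]; ring
      _ ≤ t ^ m * deltaFun α t := by gcongr; exact hδ t ht0 ht1
      _ = _ := rfl

/-! ### Decay of the moments -/

/-- The moment bound with the number of cells adapted to the frequency: `2 ^ K` cells for `ξ` of
the order of `2 ^ (K β)`, where `β` is slightly larger than `m + α`, and `N = q K`. -/
theorem exists_integral_norm_fourierTransform_pow_le {c : ℕ → ℝ} (h0 : ∀ k, 0 < c k)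
    (h1 : ∀ k, c k < 1 / 2) (hmono : Monotone c) {p : ℝ} (hp0 : 0 < p)
    (hp : Tendsto (fun n => ∏ k ∈ Finset.range n, 2 * c k) atTop (𝓝 p))
    (hc_log : Tendsto (fun k : ℕ => Real.log (1 - 2 * c k) / ((k : ℝ) + 1)) atTop (𝓝 0))
    {m : ℕ} (hm : 1 ≤ m) {α : ℝ} (hα : α ∈ Icc (0 : ℝ) 1) {φ : ℝ → ℝ} (hφ : Measurable φ)
    (hφ_zero : ∀ x ≤ 0, φ x = 0) (hφ_one : ∀ x, 1 ≤ x → φ x = 1)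
    (ν : Measure (Icc (0 : ℝ) 1)) [IsProbabilityMeasure ν]
    (hν : Tendsto (fourierTransform (ν.map Subtype.val)) (Bornology.cobounded ℝ) (𝓝 0))
    (μ : Measure ℝ) [IsProbabilityMeasure μ] (hμE : μ (cantorSet c)ᶜ = 0)
    {s A : ℝ} (hs1 : s ≤ 1) (hA : 0 ≤ A)
    (hμ : ∀ (x : ℝ) (n : ℕ), μ (Icc x (x + (1 / 2) ^ n)) ≤ ENNReal.ofReal (A * 2 ^ (-(s * n))))
    {γ : ℝ} (hγ0 : 0 < γ) (hγ : γ < s / (m + α)) (q : ℕ) :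
    ∃ B, ∀ ξ : ℝ, 1 ≤ ξ →
      ∫ ω, ‖fourierTransform (μ.map (randomMap φ ω)) ξ‖ ^ (2 * q)
        ∂productMeasure (cantorSet c) m α ν ≤ B * ξ ^ (-(q * γ)) := by
  have hE := isClosed_cantorSet c
  have hmα : 0 < m + α := by
    have : (1 : ℝ) ≤ m := by exact_mod_cast hm
    linarith [hα.1]
  obtain ⟨β, hβ1, hβ2⟩ : ∃ β, m + α < β ∧ β < s / γ :=
    exists_between (by rw [lt_div_iff₀ hγ0]; rwa [lt_div_iff₀ hmα, mul_comm] at hγ)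
  have hβ0 : 0 < β := hmα.trans hβ1
  -- `σ` is the exponent of `2 ^ (-K)` that corresponds to the exponent `γ` of `1 / ξ`.
  set σ := γ * β with hσ
  have hσs : σ < s := by rw [lt_div_iff₀ hγ0] at hβ2; linarith
  have hσ0 : 0 < σ := by positivity
  obtain ⟨b, hb0, hb⟩ :=
    exists_le_holeDelta_cantorHole h0 h1 hmono hp0 hp hc_log (m := m) hα.1 hβ1
  obtain ⟨R, hR0, hR⟩ : ∃ R > 0, ∀ η : ℝ, R ≤ |η| →
      ‖fourierTransform (ν.map Subtype.val) η‖ ≤ 1 / 2 := by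
    have := hν.norm.eventually (gt_mem_nhds (show ‖(0 : ℂ)‖ < 1 / 2 by simp))
    rw [← comap_norm_atTop, eventually_comap] at this
    obtain ⟨R, hR⟩ := eventually_atTop.1 this
    exact ⟨max R 1, by positivity, fun η hη =>
      (hR |η| ((le_max_left _ _).trans hη) η (Real.norm_eq_abs η)).le⟩
  have hδsum := summable_holeDelta (m := m) hE (zero_mem_cantorSet h0 h1) (one_mem_cantorSet h0 h1)
    (cantorSet_subset_Icc c) hm hα
  have hlog2 : 0 < Real.log 2 := Real.log_pos (by norm_num)
  have hKbound : ∀ K : ℕ, (K : ℝ) * 2 ^ (-(s * K)) ≤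
      1 / ((s - σ) * Real.log 2) * 2 ^ (-(σ * K)) := by
    intro K
    have hu : 0 < (s - σ) * Real.log 2 := mul_pos (by linarith) hlog2
    have h2 : (s - σ) * Real.log 2 * K ≤ 2 ^ ((s - σ) * K) := by
      rw [Real.rpow_def_of_pos (by norm_num)]
      have := Real.add_one_le_exp (Real.log 2 * ((s - σ) * K))
      linarith
    have h3 : (2 : ℝ) ^ (-(s * K)) * 2 ^ ((s - σ) * K) = 2 ^ (-(σ * K)) := by
      rw [← Real.rpow_add (by norm_num)]; congr 1; ring
    rw [← h3, div_mul_eq_mul_div, one_mul, le_div_iff₀ hu]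
    have : (0 : ℝ) < 2 ^ (-(s * K)) := by positivity
    nlinarith
  have hmoment : ∀ (ξ : ℝ) (K : ℕ), (1 ≤ K → R ≤ ξ * (b * 2 ^ (-(β * K)))) → 0 < ξ →
      ∫ ω, ‖fourierTransform (μ.map (randomMap φ ω)) ξ‖ ^ (2 * q)
        ∂productMeasure (cantorSet c) m α ν ≤
      (2 * q).factorial * ((q * K : ℕ) * (A * 2 ^ (-(s * K)))) ^ q + (1 / 2) ^ (q * K) := by
    intro ξ K hK hξ
    have hl : ∀ l : Fin (2 ^ K - 1), (l : ℕ) + 1 < 2 ^ K := fun l => by have := l.2; omega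
    refine integral_norm_fourierTransform_pow_le hE hδsum hφ hφ_zero hφ_one ν μ hμE
      (measurable_cantorIndex c K) (M := 2 ^ K - 1) ?_ (by positivity) ?_
      (hole := fun l => ⟨cantorHole c K l, cantorHole_mem h0 h1 hmono (hl l)⟩) ?_ ?_ ?_ q (q * K)
    · intro x hx
      have := (mem_Icc_cantorIndex h0 h1 hmono K hx).1
      omega
    · intro j
      refine le_trans ?_ (hμ (leftEndpoint c K j) K)
      calc μ (cantorIndex c K ⁻¹' {j}) ≤ μ (cantorSet c ∩ cantorIndex c K ⁻¹' {j}) := by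
            rw [Measure.measure_inter_eq_of_ae]
            exact hμE
        _ ≤ _ := by
            refine measure_mono fun x hx => ?_
            have h3 := (mem_Icc_cantorIndex h0 h1 hmono K hx.1).2
            have h4 : cantorIndex c K x = j := hx.2
            rw [h4] at h3
            exact ⟨h3.1, h3.2.trans (by linarith [stageLength_le h0 h1 K])⟩
    · intro l l' h
      exact Fin.ext (cantorHole_injOn h0 h1 hmono K (hl l) (hl l') (congrArg Subtype.val h))
    · intro l x hx
      have h5 : sSup (cantorHole c K l) = leftEndpoint c K (l + 1) :=
        csSup_Ioo (leftEndpoint_add_lt h0 h1 hmono (Nat.lt_succ_self _) (hl l))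
      simp only [h5]
      exact leftEndpoint_succ_le_iff h0 h1 hmono hx (hl l)
    · intro l k hk
      refine hR _ ?_
      have hK1 : 1 ≤ K := by
        by_contra hcon
        obtain rfl : K = 0 := by omega
        exact absurd (hl l) (by simp)
      have hk1 : (1 : ℝ) ≤ |(k : ℝ)| := by exact_mod_cast Int.one_le_abs hk
      have hδl := hb K l (hl l)
      have hδ0 := holeDelta_nonneg m α (cantorHole c K l)
      rw [abs_mul, abs_mul, abs_of_pos hξ, abs_of_nonneg hδ0]
      calc R ≤ ξ * (b * 2 ^ (-(β * K))) := hK hK1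
        _ ≤ ξ * holeDelta m α (cantorHole c K l) := by gcongr
        _ ≤ _ := by
            have := mul_nonneg hξ.le hδ0
            nlinarith
  set D : ℝ := (2 * q).factorial * (q * A * (1 / ((s - σ) * Real.log 2))) ^ q + 1 with hD
  have hsσ : 0 < s - σ := by linarith
  have hD0 : 0 ≤ D := by positivity
  refine ⟨D * (2 ^ β * R / b) ^ (q * γ), fun ξ hξ => ?_⟩
  have hξ0 : 0 < ξ := one_pos.trans_le hξ
  set y := Real.logb 2 (ξ * b / R) / β with hy
  set K := ⌊y⌋₊ with hK
  have hx0 : 0 < ξ * b / R := by positivity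
  have hy2 : (2 : ℝ) ^ (β * y) = ξ * b / R := by
    rw [hy, mul_div_cancel₀ _ hβ0.ne', Real.rpow_logb (by norm_num) (by norm_num) hx0]
  have hK1 : 1 ≤ K → R ≤ ξ * (b * 2 ^ (-(β * K))) := by
    intro hK1
    have hKy : (K : ℝ) ≤ y := (Nat.le_floor_iff' (by omega)).1 le_rfl
    have h2 : (2 : ℝ) ^ (β * K) ≤ ξ * b / R := by
      rw [← hy2]
      exact Real.rpow_le_rpow_of_exponent_le (by norm_num) (by gcongr)
    rw [le_div_iff₀ hR0] at h2
    rw [Real.rpow_neg (by norm_num), ← mul_assoc, ← div_eq_mul_inv, le_div_iff₀ (by positivity)]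
    linarith
  have hK2 : (2 : ℝ) ^ (-(β * K)) ≤ 2 ^ β * R / b * ξ⁻¹ := by
    have hKy : y ≤ K + 1 := (Nat.lt_floor_add_one y).le
    have h2 : ξ * b / R ≤ (2 : ℝ) ^ (β * K) * 2 ^ β := by
      rw [← hy2, ← Real.rpow_add (by norm_num)]
      exact Real.rpow_le_rpow_of_exponent_le (by norm_num) (by nlinarith)
    rw [div_le_iff₀ hR0] at h2
    rw [Real.rpow_neg (by norm_num), inv_le_comm₀ (by positivity) (by positivity),
      mul_inv, inv_div, inv_inv, div_mul_eq_mul_div, div_le_iff₀ (by positivity)]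
    linarith
  have hq : (0 : ℝ) ≤ q := Nat.cast_nonneg q
  have hpow : (2 : ℝ) ^ (-(σ * K * q)) ≤ (2 ^ β * R / b) ^ (q * γ) * ξ ^ (-(q * γ)) := by
    calc (2 : ℝ) ^ (-(σ * K * q)) = ((2 : ℝ) ^ (-(β * K))) ^ (q * γ) := by
          rw [← Real.rpow_mul (by norm_num)]; congr 1; rw [hσ]; ring
      _ ≤ (2 ^ β * R / b * ξ⁻¹) ^ (q * γ) :=
          Real.rpow_le_rpow (by positivity) hK2 (by positivity)
      _ = _ := by
          rw [Real.mul_rpow (by positivity) (by positivity), Real.inv_rpow hξ0.le,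
            Real.rpow_neg hξ0.le]
  have hpow2 : ((2 : ℝ) ^ (-(σ * K))) ^ q = 2 ^ (-(σ * K * q)) := by
    rw [← Real.rpow_natCast, ← Real.rpow_mul (by norm_num)]; congr 1; ring
  calc _ ≤ _ := hmoment ξ K hK1 hξ0
    _ = (2 * q).factorial * (q * A * (K * 2 ^ (-(s * K)))) ^ q + (1 / 2) ^ (q * K) := by
        push_cast; ring
    _ ≤ (2 * q).factorial * (q * A * (1 / ((s - σ) * Real.log 2) * 2 ^ (-(σ * K)))) ^ q +
        2 ^ (-(σ * K * q)) := by
        refine add_le_add ?_ ?_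
        · exact mul_le_mul_of_nonneg_left (pow_le_pow_left₀ (by positivity)
            (mul_le_mul_of_nonneg_left (hKbound K) (by positivity)) q) (by positivity)
        · rw [one_div, inv_pow, ← Real.rpow_natCast, ← Real.rpow_neg (by norm_num)]
          refine Real.rpow_le_rpow_of_exponent_le (by norm_num) ?_
          push_cast
          have : 0 ≤ (q : ℝ) * K := by positivity
          nlinarith
    _ = D * 2 ^ (-(σ * K * q)) := by
        rw [← mul_assoc (q * A : ℝ), mul_pow, hpow2, hD]; ring
    _ ≤ D * ((2 ^ β * R / b) ^ (q * γ) * ξ ^ (-(q * γ))) := by gcongr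
    _ = _ := by ring

/-! ### From moments to almost sure decay -/

/-- If all even moments of a sequence of bounded random variables decay at the rates that belong
to the exponent `g`, then almost surely the sequence decays at the rate that belongs to any
smaller exponent. -/
theorem ae_exists_le_of_moments {Ω : Type*} [MeasurableSpace Ω] (P : Measure Ω)
    [IsProbabilityMeasure P] {X : ℕ → Ω → ℝ} (hX : ∀ n, Measurable (X n))
    (hX0 : ∀ n ω, 0 ≤ X n ω) (hX1 : ∀ n ω, X n ω ≤ 1) {g g' : ℝ} (hg : g' < g)
    (hmom : ∀ q : ℕ, ∃ C, ∀ n : ℕ, ∫ ω, X n ω ^ (2 * q) ∂P ≤ C * ((n : ℝ) + 1) ^ (-(q * g))) :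
    ∀ᵐ ω ∂P, ∃ B, 0 ≤ B ∧ ∀ n : ℕ, X n ω ≤ B * ((n : ℝ) + 1) ^ (-(g' / 2)) := by
  obtain ⟨q, hq⟩ := exists_nat_ge (2 / (g - g'))
  rw [div_le_iff₀ (by linarith)] at hq
  have hq0 : q ≠ 0 := by rintro rfl; norm_num at hq
  obtain ⟨C, hC⟩ := hmom q
  have hC0 : 0 ≤ C := by
    have := (integral_nonneg fun ω => pow_nonneg (hX0 0 ω) (2 * q)).trans (hC 0)
    simpa using this
  let Y : ℕ → Ω → ℝ := fun n ω => X n ω ^ (2 * q) * ((n : ℝ) + 1) ^ (q * g')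
  have hY0 : ∀ n ω, 0 ≤ Y n ω := fun n ω => mul_nonneg (pow_nonneg (hX0 n ω) _) (by positivity)
  have hYm : ∀ n, Measurable (Y n) := fun n => ((hX n).pow_const _).mul_const _
  have hYint : ∀ n, Integrable (Y n) P := fun n => by
    refine Integrable.mul_const (Integrable.of_bound ((hX n).pow_const _).aestronglyMeasurable 1
      (ae_of_all _ fun ω => ?_)) _
    rw [Real.norm_of_nonneg (pow_nonneg (hX0 n ω) _)]
    exact pow_le_one₀ (hX0 n ω) (hX1 n ω)
  have hYle : ∀ n, ∫⁻ ω, ENNReal.ofReal (Y n ω) ∂P ≤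
      ENNReal.ofReal (C * (1 / ((n + 1 : ℕ) : ℝ) ^ 2)) := by
    intro n
    rw [← ofReal_integral_eq_lintegral_ofReal (hYint n) (ae_of_all _ (hY0 n))]
    refine ENNReal.ofReal_le_ofReal ?_
    have hn1 : (1 : ℝ) ≤ n + 1 := by linarith [(Nat.cast_nonneg n : (0 : ℝ) ≤ n)]
    calc ∫ ω, Y n ω ∂P = (∫ ω, X n ω ^ (2 * q) ∂P) * ((n : ℝ) + 1) ^ (q * g') :=
          integral_mul_const _ _
      _ ≤ C * ((n : ℝ) + 1) ^ (-(q * g)) * ((n : ℝ) + 1) ^ (q * g') := by gcongr; exact hC n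
      _ = C * ((n : ℝ) + 1) ^ (-(q * (g - g'))) := by
          rw [mul_assoc, ← Real.rpow_add (by positivity)]; congr 2; ring
      _ ≤ C * ((n : ℝ) + 1) ^ (-2 : ℝ) := by gcongr
      _ = _ := by
          rw [Real.rpow_neg (by positivity), one_div]
          norm_num
  have hsum : ∫⁻ ω, ∑' n, ENNReal.ofReal (Y n ω) ∂P ≠ ∞ := by
    rw [lintegral_tsum fun n => (hYm n).ennreal_ofReal.aemeasurable]
    refine ne_top_of_le_ne_top ?_ (ENNReal.tsum_le_tsum hYle)
    have hs : Summable fun n : ℕ => C * (1 / ((n + 1 : ℕ) : ℝ) ^ 2) :=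
      ((summable_nat_add_iff 1).2 (Real.summable_one_div_nat_pow.2 one_lt_two)).mul_left C
    rw [← ENNReal.ofReal_tsum_of_nonneg (fun n => by positivity) hs]
    exact ENNReal.ofReal_ne_top
  have hae := ae_lt_top (Measurable.tsum fun n => (hYm n).ennreal_ofReal) hsum
  refine hae.mono fun ω hω => ?_
  set T := (∑' n, ENNReal.ofReal (Y n ω)).toReal with hT
  have hT0 : 0 ≤ T := ENNReal.toReal_nonneg
  refine ⟨T + 1, by linarith, fun n => ?_⟩
  have hYT : Y n ω ≤ T := by
    rw [← ENNReal.toReal_ofReal (hY0 n ω)]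
    exact ENNReal.toReal_mono hω.ne (ENNReal.le_tsum n)
  rw [← pow_le_pow_iff_left₀ (hX0 n ω) (by positivity) (by omega : 2 * q ≠ 0), mul_pow]
  have hpow : (((n : ℝ) + 1) ^ (-(g' / 2))) ^ (2 * q) = (((n : ℝ) + 1) ^ (q * g'))⁻¹ := by
    rw [← Real.rpow_natCast, ← Real.rpow_mul (by positivity), ← Real.rpow_neg (by positivity)]
    congr 1; push_cast; ring
  rw [hpow, ← div_eq_mul_inv, le_div_iff₀ (by positivity)]
  calc _ ≤ T := hYT
    _ ≤ (T + 1) ^ 1 := by linarith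
    _ ≤ (T + 1) ^ (2 * q) := pow_le_pow_right₀ (by linarith) (by omega)

theorem norm_fourierTransform_neg (μ : Measure ℝ) (ξ : ℝ) :
    ‖fourierTransform μ (-ξ)‖ = ‖fourierTransform μ ξ‖ := by
  rw [fourierTransform_eq, fourierTransform_eq, ← Complex.norm_conj (∫ x, phase (-(ξ * x)) ∂μ),
    ← integral_conj]
  simp_rw [conj_phase]
  simp

theorem norm_fourierTransform_sub_le (μ : Measure ℝ) [IsProbabilityMeasure μ] {R : ℝ}
    (hR : ∀ᵐ x ∂μ, |x| ≤ R) (ξ η : ℝ) :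
    ‖fourierTransform μ ξ - fourierTransform μ η‖ ≤ 2 * Real.pi * R * |ξ - η| := by
  have hint : ∀ ξ : ℝ, Integrable (fun x => phase (-(ξ * x))) μ := fun ξ =>
    Integrable.of_bound (continuous_phase.comp (by fun_prop)).aestronglyMeasurable 1
      (ae_of_all _ fun x => (norm_phase _).le)
  rw [fourierTransform_eq, fourierTransform_eq, ← integral_sub (hint ξ) (hint η)]
  refine (norm_integral_le_of_norm_le_const (C := 2 * Real.pi * R * |ξ - η|)
    (hR.mono fun x hx => ?_)).trans (by simp)
  refine (norm_phase_sub_le _ _).trans ?_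
  have : -(ξ * x) - -(η * x) = -((ξ - η) * x) := by ring
  rw [this, abs_neg, abs_mul]
  calc _ = 2 * Real.pi * |x| * |ξ - η| := by ring
    _ ≤ _ := by gcongr

/-- It is enough to know the decay of the Fourier transform of a compactly supported measure on
the set of the square roots of the positive integers: the transform is Lipschitz and that set
comes within distance `1 / ξ` of any `ξ ≥ 1`. -/
theorem le_dimFMeasure_of_sqrt {μ : Measure ℝ} [IsProbabilityMeasure μ] {R : ℝ}
    (hR : ∀ᵐ x ∂μ, |x| ≤ R) {t B : ℝ} (ht0 : 0 ≤ t) (ht1 : t ≤ 1) (hB0 : 0 ≤ B)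
    (hB : ∀ n : ℕ, ‖fourierTransform μ (√((n : ℝ) + 1))‖ ≤ B * ((n : ℝ) + 1) ^ (-(t / 4))) :
    t ≤ dimFMeasure μ := by
  have hR0 : 0 ≤ R := by
    obtain ⟨x, hx⟩ := hR.exists
    exact (abs_nonneg x).trans hx
  have hle1 : ∀ ξ, ‖fourierTransform μ ξ‖ ≤ 1 := fun ξ => norm_integral_phase_le _ _
  have hge1 : ∀ ξ : ℝ, 1 ≤ ξ →
      ‖fourierTransform μ ξ‖ ≤ (B * 2 ^ (t / 4) + 2 * Real.pi * R) * ξ ^ (-t / 2) := by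
    intro ξ hξ
    have hξ0 : 0 < ξ := by linarith
    obtain ⟨n, hn⟩ : ∃ n : ℕ, ⌊ξ ^ 2⌋₊ = n + 1 :=
      Nat.exists_eq_succ_of_ne_zero (Nat.floor_pos.2 (one_le_pow₀ hξ)).ne'
    have hn1 : (n : ℝ) + 1 ≤ ξ ^ 2 := by
      have := Nat.floor_le (sq_nonneg ξ); rw [hn] at this; exact_mod_cast this
    have hn2 : ξ ^ 2 < (n : ℝ) + 1 + 1 := by
      have := Nat.lt_floor_add_one (ξ ^ 2); rw [hn] at this; exact_mod_cast this
    set r := √((n : ℝ) + 1) with hr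
    have hr2 : r ^ 2 = n + 1 := Real.sq_sqrt (by positivity)
    have hr0 : 0 ≤ r := Real.sqrt_nonneg _
    have hrξ : r ≤ ξ := by rw [← pow_le_pow_iff_left₀ hr0 hξ0.le two_ne_zero, hr2]; exact hn1
    have hdist : |ξ - r| ≤ ξ⁻¹ := by
      rw [abs_of_nonneg (by linarith), inv_eq_one_div, le_div_iff₀ hξ0]
      nlinarith
    have h1 : ξ⁻¹ ≤ ξ ^ (-t / 2) := by
      rw [← Real.rpow_neg_one]
      exact Real.rpow_le_rpow_of_exponent_le hξ (by linarith)
    have h2 : ((n : ℝ) + 1) ^ (-(t / 4)) ≤ 2 ^ (t / 4) * ξ ^ (-t / 2) := by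
      have h3 : ξ ^ 2 / 2 ≤ (n : ℝ) + 1 := by linarith [(Nat.cast_nonneg n : (0 : ℝ) ≤ n)]
      calc _ ≤ (ξ ^ 2 / 2) ^ (-(t / 4)) :=
            Real.rpow_le_rpow_of_nonpos (by positivity) h3 (by linarith)
        _ = _ := by
            rw [Real.div_rpow (by positivity) (by norm_num), ← Real.rpow_natCast ξ 2,
              ← Real.rpow_mul hξ0.le, Real.rpow_neg (by norm_num), div_inv_eq_mul, mul_comm]
            congr 2; push_cast; ring
    have h4 : fourierTransform μ ξ =
        fourierTransform μ r + (fourierTransform μ ξ - fourierTransform μ r) := by ring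
    rw [h4]
    calc _ ≤ ‖fourierTransform μ r‖ + ‖fourierTransform μ ξ - fourierTransform μ r‖ :=
          norm_add_le _ _
      _ ≤ B * ((n : ℝ) + 1) ^ (-(t / 4)) + 2 * Real.pi * R * |ξ - r| :=
          add_le_add (hB n) (norm_fourierTransform_sub_le μ hR ξ r)
      _ ≤ B * (2 ^ (t / 4) * ξ ^ (-t / 2)) + 2 * Real.pi * R * ξ ^ (-t / 2) := by
          gcongr; exact hdist.trans h1
      _ = _ := by ring
  refine le_csSup ⟨1, fun s hs => hs.1.2⟩
    ⟨⟨ht0, ht1⟩, max 1 (B * 2 ^ (t / 4) + 2 * Real.pi * R), fun ξ hξ => ?_⟩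
  have habs : ‖fourierTransform μ ξ‖ = ‖fourierTransform μ |ξ|‖ := by
    rcases abs_choice ξ with h | h
    · rw [h]
    · rw [h, norm_fourierTransform_neg]
  rw [habs]
  have hξ' : 0 < |ξ| := abs_pos.2 hξ
  rcases le_total 1 |ξ| with h | h
  · refine (hge1 _ h).trans ?_
    gcongr
    exact le_max_right _ _
  · refine (hle1 _).trans (one_le_mul_of_one_le_of_one_le (le_max_left _ _) ?_)
    exact Real.one_le_rpow_of_pos_of_le_one_of_nonpos hξ' h (by linarith)

/-! ### The translate and the conclusion -/

/-- By Tonelli's theorem a measure has a translate that gives positive mass to a given set of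
positive Lebesgue measure. -/
theorem exists_translate_pos (μ : Measure ℝ) [SFinite μ] (hμ : μ ≠ 0) {C : Set ℝ}
    (hC : MeasurableSet C) (hCpos : 0 < volume C) :
    ∃ t : ℝ, 0 < μ ((fun x => x + t) ⁻¹' C) := by
  by_contra! hcon
  let S : Set (ℝ × ℝ) := {p | p.1 + p.2 ∈ C}
  have hS : MeasurableSet S := (measurable_fst.add measurable_snd) hC
  have h1 : (μ.prod volume) S = 0 := by
    rw [Measure.prod_apply_symm hS, lintegral_eq_zero_iff (measurable_measure_prodMk_right hS)]
    exact ae_of_all _ fun t => le_antisymm (hcon t) bot_le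
  rw [Measure.prod_apply hS] at h1
  have h2 : ∀ x : ℝ, volume (Prod.mk x ⁻¹' S) = volume C := fun x =>
    measure_preimage_add volume x C
  simp only [h2, lintegral_const] at h1
  rcases mul_eq_zero.1 h1 with h | h
  · exact hCpos.ne' h
  · exact hμ (Measure.measure_univ_eq_zero.1 h)

theorem exists_translate_measure {s : ℝ} (hs : 0 < s) {F : Set ℝ} (hF : MeasurableSet F)
    (hFs : 0 < Measure.hausdorffMeasure s F) {C : Set ℝ} (hC : MeasurableSet C)
    (hCpos : 0 < volume C) :
    ∃ (t : ℝ) (μ : Measure ℝ) (A : ℝ), IsProbabilityMeasure μ ∧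
      μ (C ∩ (fun x => x + t) '' F)ᶜ = 0 ∧ 0 ≤ A ∧
      ∀ (x : ℝ) (n : ℕ), μ (Icc x (x + (1 / 2) ^ n)) ≤ ENNReal.ofReal (A * 2 ^ (-(s * n))) := by
  obtain ⟨μ₀, hfin, hne, hF0, hμ₀⟩ := exists_frostman_measure hs hF hFs
  obtain ⟨t, ht⟩ := exists_translate_pos μ₀ hne hC hCpos
  set μ₁ := (μ₀.map (fun x => x + t)).restrict C with hμ₁
  have hmeas : Measurable fun x : ℝ => x + t := measurable_add_const t
  have himage : (fun x => x + t) '' F = (fun x => x - t) ⁻¹' F := by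
    ext y; simp [sub_eq_add_neg]
  have hFt : MeasurableSet ((fun x => x + t) '' F) := by
    rw [himage]; exact (measurable_sub_const t) hF
  have huniv : μ₁ univ = μ₀ ((fun x => x + t) ⁻¹' C) := by
    rw [hμ₁, Measure.restrict_apply_univ, Measure.map_apply hmeas hC]
  have hpos : μ₁ univ ≠ 0 := huniv ▸ ht.ne'
  have hneμ₁ : NeZero μ₁ := ⟨fun h => hpos (by rw [h]; simp)⟩
  have htop : (μ₁ univ)⁻¹ ≠ ∞ := ENNReal.inv_ne_top.2 hpos
  refine ⟨t, (μ₁ univ)⁻¹ • μ₁, ((μ₁ univ)⁻¹ * 2).toReal, isProbabilityMeasureSMul, ?_,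
    ENNReal.toReal_nonneg, fun x n => ?_⟩
  · rw [Measure.smul_apply, smul_eq_mul, mul_eq_zero]
    right
    rw [compl_inter]
    refine measure_union_null ?_ ?_
    · rw [hμ₁, Measure.restrict_apply hC.compl]; simp
    · refine le_antisymm ((Measure.restrict_le_self _).trans (le_of_eq ?_)) bot_le
      rw [Measure.map_apply hmeas hFt.compl, himage]
      convert hF0 using 2
      ext y; simp
  · rw [Measure.smul_apply, smul_eq_mul, ENNReal.ofReal_mul ENNReal.toReal_nonneg,
      ENNReal.ofReal_toReal (ENNReal.mul_ne_top htop (by norm_num)), mul_assoc]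
    gcongr
    refine (Measure.restrict_le_self _).trans ?_
    rw [Measure.map_apply hmeas measurableSet_Icc]
    refine le_trans (measure_mono fun y hy => ?_) (hμ₀ (x - t) n)
    obtain ⟨h1, h2⟩ : x ≤ y + t ∧ y + t ≤ x + (1 / 2) ^ n := hy
    exact ⟨by linarith, by linarith⟩

theorem dimFMeasure_nonneg (μ : Measure ℝ) : 0 ≤ dimFMeasure μ :=
  Real.sSup_nonneg fun _ h => h.1.1

theorem dimFMeasure_le_one (μ : Measure ℝ) : dimFMeasure μ ≤ 1 :=
  Real.sSup_le (fun _ h => h.1.2) zero_le_one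

theorem dimFSet_nonneg (F : Set ℝ) : 0 ≤ dimFSet F :=
  Real.sSup_nonneg fun _ ⟨_, _, _, h⟩ => h ▸ dimFMeasure_nonneg _

theorem dimFMeasure_le_dimFSet {F : Set ℝ} (μ : Measure ℝ) [h : IsProbabilityMeasure μ]
    (hμ : μ F = 1) : dimFMeasure μ ≤ dimFSet F := by
  refine le_csSup ⟨1, ?_⟩ ⟨μ, h, hμ, rfl⟩
  rintro _ ⟨μ', -, -, rfl⟩
  exact dimFMeasure_le_one μ'

theorem le_one_of_hausdorffMeasure_pos {s : ℝ} {F : Set ℝ}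
    (hFs : 0 < Measure.hausdorffMeasure s F) : s ≤ 1 := by
  by_contra! hs
  have h1 : Measure.hausdorffMeasure s (univ : Set ℝ) = 0 := by
    have h2 : dimH (univ : Set ℝ) < (s.toNNReal : ℝ≥0∞) := by
      rw [Real.dimH_univ]
      exact_mod_cast Real.one_lt_toNNReal.2 hs
    have h3 := hausdorffMeasure_of_dimH_lt h2
    rwa [Real.coe_toNNReal s (by linarith)] at h3
  exact hFs.ne' (measure_mono_null (subset_univ F) h1)

end RandomDiffeo

theorem theorem4
    -- the regularity
    (m : ℕ) (hm : 1 ≤ m) (α : ℝ) (hα : α ∈ Set.Icc (0 : ℝ) 1)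
    -- the function used to extend the random map to the line
    (φ : ℝ → ℝ) (hφ_mono : Monotone φ) (hφ_smooth : ContDiff ℝ (⊤ : ℕ∞) φ)
    (hφ_zero : ∀ x ≤ 0, φ x = 0) (hφ_one : ∀ x, 1 ≤ x → φ x = 1)
    -- the probability measure on the unit interval, with Fourier transform tending to zero
    (ν : Measure (Set.Icc (0 : ℝ) 1)) [IsProbabilityMeasure ν]
    (hν : Tendsto (RandomDiffeo.fourierTransform (ν.map Subtype.val))
      (Bornology.cobounded ℝ) (𝓝 0))
    -- the contraction ratios of the Cantor set; `c k` is the ratio of step `k + 1`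
    (c : ℕ → ℝ) (hc_mono : Monotone c) (hc_pos : ∀ k, 0 < c k) (hc_lt : ∀ k, c k < 1 / 2)
    (hc_lim : Tendsto c atTop (𝓝 (1 / 2)))
    (hc_prod : ∃ p : ℝ, 0 < p ∧
      Tendsto (fun n => ∏ k ∈ Finset.range n, 2 * c k) atTop (𝓝 p))
    (hc_log : Tendsto (fun k : ℕ => Real.log (1 - 2 * c k) / ((k : ℝ) + 1)) atTop (𝓝 0))
    -- the Borel set
    (s : ℝ) (hs : 0 ≤ s) (F : Set ℝ) (hF : MeasurableSet F)
    (hFs : 0 < Measure.hausdorffMeasure s F) :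
    ∃ t : ℝ, ∀ᵐ ω ∂(RandomDiffeo.productMeasure (RandomDiffeo.cantorSet c) m α ν),
      s / (m + α) ≤ RandomDiffeo.dimFSet
        (RandomDiffeo.randomMap φ ω ''
          (RandomDiffeo.cantorSet c ∩ (fun x => x + t) '' F)) := by
  rcases hs.eq_or_lt with rfl | hs0
  · exact ⟨0, ae_of_all _ fun ω => by rw [zero_div]; exact dimFSet_nonneg _⟩
  obtain ⟨p, hp0, hp⟩ := hc_prod
  have hs1 := le_one_of_hausdorffMeasure_pos hFs
  have hE := isClosed_cantorSet c
  obtain ⟨t, μ, A, hprob, hμ0, hA, hμ⟩ := exists_translate_measure hs0 hF hFs hE.measurableSet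
    (volume_cantorSet_pos hc_pos hc_lt hc_mono hp0 hp)
  have hμE : μ (cantorSet c)ᶜ = 0 := measure_mono_null (compl_subset_compl.2 inter_subset_left) hμ0
  have hφ : Measurable φ := hφ_mono.measurable
  have hmα : 1 ≤ m + α := by
    have : (1 : ℝ) ≤ m := by exact_mod_cast hm
    linarith [hα.1]
  have hdim0 : 0 < s / (m + α) := by positivity
  have hdim1 : s / (m + α) ≤ 1 := by rw [div_le_one (by linarith)]; linarith
  refine ⟨t, ?_⟩
  have key : ∀ γ : ℝ, 0 ≤ γ → γ < s / (m + α) →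
      ∀ᵐ ω ∂productMeasure (cantorSet c) m α ν, γ ≤ dimFMeasure (μ.map (randomMap φ ω)) := by
    intro γ hγ0 hγ
    obtain ⟨γ', hγ1, hγ2⟩ := exists_between hγ
    have hae := ae_exists_le_of_moments (productMeasure (cantorSet c) m α ν)
      (X := fun n ω => ‖fourierTransform (μ.map (randomMap φ ω)) (√((n : ℝ) + 1))‖)
      (g := γ' / 2) (g' := γ / 2)
      (fun n => (measurable_fourierTransform_map hE hφ μ _).norm) (fun n ω => norm_nonneg _)
      (fun n ω => by
        rw [fourierTransform_map_randomMap hE hφ]; exact norm_integral_phase_le _ _)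
      (by linarith) fun q => by
        obtain ⟨B, hB⟩ := exists_integral_norm_fourierTransform_pow_le hc_pos hc_lt hc_mono hp0 hp
          hc_log hm hα hφ hφ_zero hφ_one ν hν μ hμE hs1 hA hμ (hγ0.trans_lt hγ1) hγ2 q
        refine ⟨B, fun n => ?_⟩
        have hn : (1 : ℝ) ≤ n + 1 := by linarith [(Nat.cast_nonneg n : (0 : ℝ) ≤ n)]
        refine (hB _ (Real.one_le_sqrt.2 hn)).trans (le_of_eq ?_)
        rw [Real.sqrt_eq_rpow, ← Real.rpow_mul (by linarith)]
        congr 2; ring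
    refine hae.mono fun ω ⟨B, hB0, hB⟩ => ?_
    have hmeas := measurable_randomMap_left hE hφ ω
    have : IsProbabilityMeasure (μ.map (randomMap φ ω)) :=
      Measure.isProbabilityMeasure_map hmeas.aemeasurable
    refine le_dimFMeasure_of_sqrt (R := 1 + ∑' U : holes (cantorSet c), holeDelta m α U)
      ?_ hγ0 (hγ.le.trans hdim1) hB0 fun n => ?_
    · rw [ae_map_iff hmeas.aemeasurable (measurableSet_le measurable_abs measurable_const)]
      have hae' : ∀ᵐ x ∂μ, x ∈ cantorSet c := hμE
      exact hae'.mono fun x hx => abs_randomMap_le hE (cantorSet_subset_Icc c)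
        (summable_holeDelta hE (zero_mem_cantorSet hc_pos hc_lt) (one_mem_cantorSet hc_pos hc_lt)
          (cantorSet_subset_Icc c) hm hα) hφ_zero hφ_one hx ω
    · have := hB n
      rwa [div_div, show (2 : ℝ) * 2 = 4 by norm_num] at this
  have hseq : ∀ᵐ ω ∂productMeasure (cantorSet c) m α ν, ∀ j : ℕ,
      s / (m + α) * (1 - 1 / ((j : ℝ) + 1)) ≤ dimFMeasure (μ.map (randomMap φ ω)) := by
    refine ae_all_iff.2 fun j => key _ (mul_nonneg hdim0.le ?_) ?_
    · rw [sub_nonneg, div_le_one (by positivity)]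
      linarith [(Nat.cast_nonneg j : (0 : ℝ) ≤ j)]
    · have : 0 < 1 / ((j : ℝ) + 1) := by positivity
      nlinarith
  refine hseq.mono fun ω hω => ?_
  have hmeas := measurable_randomMap_left hE hφ ω
  have : IsProbabilityMeasure (μ.map (randomMap φ ω)) :=
    Measure.isProbabilityMeasure_map hmeas.aemeasurable
  have hlim : Tendsto (fun j : ℕ => s / (m + α) * (1 - 1 / ((j : ℝ) + 1))) atTop
      (𝓝 (s / (m + α))) := by
    simpa using (tendsto_one_div_add_atTop_nhds_zero_nat.const_sub 1).const_mul (s / (m + α))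
  refine (le_of_tendsto' hlim hω).trans (dimFMeasure_le_dimFSet _ (le_antisymm prob_le_one ?_))
  refine le_trans (le_of_eq ?_) (Measure.le_map_apply_image hmeas.aemeasurable _)
  exact ((prob_compl_eq_zero_iff₀ (NullMeasurableSet.of_compl
    (NullMeasurableSet.of_null hμ0))).1 hμ0).symm
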